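/- Let $a<b$ be real numbers and $s\in\mathbb{R}$. On the bounded interval $(a,b)$ consider the differential expression $$\alpha_s=\frac{d}{dx}-\frac{s+\frac12}{x-a}.$$ In the complex Hilbert space $L^2((a,b))=L^2((a,b);dx)$ let $A_{s,max}f=\alpha_s f$ with $$\operatorname{dom}(A_{s,max})=\{f\in L^2((a,b)) \mid f\in AC_{loc}((a,b)),\ \alpha_s f\in L^2((a,b))\},$$ where $AC_{loc}((a,b))$ is the set of complex-valued functions that are absolutely continuous on every compact subinterval of $(a,b)$. Let $\dot A_{s,min}$ be the restriction of $A_{s,max}$ to those $f$ in its domain whose support is a compact subset of $(a,b)$, and let $A_{s,min}=\overline{\dot A_{s,min}}$ be its closure. Let $H^1_0((a,b))$ be the completion of $C_0^\infty((a,b))$ in the norm of $H^1((a,b))$, regarded as a subspace of $L^2((a,b))$. For $f\in AC_{loc}((a,b))$, the condition $f(a)=0$ means $\lim_{x\downarrow a}f(x)=0$, and $f(b)=0$ means $\lim_{x\uparrow b}f(x)=0$. **Theorem 3.2.** For every $s\in\mathbb{R}$ the operators $\dot A_{s,min}$ and $\alpha_s|_{C_0^\infty((a,b))}$ are closable and have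 the same closure $A_{s,min}$. Moreover: (i) For all $s\in\mathbb{R}\setminus\{0\}$, $\operatorname{dom}(A_{s,min})=H^1_0((a,b))$. (ii) For $s=0$, $C_0^\infty((a,b))$ is a core for $A_{0,min}$, hence so is $H^1_0((a,b))$, and $H^1_0((a,b))\subsetneq\operatorname{dom}(A_{0,min})$. Furthermore $$\operatorname{dom}(A_{0,min})=\{f\in L^2((a,b)) \mid f\in AC_{loc}((a,b)),\ f(a)=0=f(b),\ \alpha_0 f\in L^2((a,b))\},$$ $$\operatorname{dom}(A_{0,max})=\{f\in L^2((a,b)) \mid f\in AC_{loc}((a,b)),\ \alpha_0 f\in L^2((a,b))\}=\{f\in L^2((a,b)) \mid f\in AC_{loc}((a,b)),\ f(a)=0,\ \alpha_0 f\in L^2((a,b))\}.$$ In both descriptions the condition $f(a)=0$ can be replaced, for any fixed $R>0$, by $$\lim_{x\downarrow a}\frac{f(x)}{[(x-a)\ln(R/(x-a))]^{1/2}}=0,$$ and in the description of $\operatorname{dom}(A_{0,min})$ the condition $f(b)=0$ can be replaced (whether or not the condition at $a$ is replaced) by $$\lim_{x\uparrow b}\frac{f(x)}{(b-x)^{1/2}}=0.$$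 (iii) For $s\in(-\infty,-1]\cup(0,\infty)$, $$\operatorname{dom}(A_{s,max})=\{f\in L^2((a,b)) \mid f\in AC_{loc}((a,b)),\ \alpha_s f\in L^2((a,b))\}=\{f\in L^2((a,b)) \mid f\in AC_{loc}((a,b)),\ f(a)=0,\ \alpha_s f\in L^2((a,b))\},$$ and the condition $f(a)=0$ can be replaced by $\lim_{x\downarrow a} f(x)/(x-a)^{1/2}=0$. (iv) For $s\in(-1,0)$, $H^1_0((a,b))=\operatorname{dom}(A_{s,min})\subsetneq\operatorname{dom}(A_{s,max})$. -/

import Mathlib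

open MeasureTheory Set Filter Topology
open scoped ContDiff

namespace FirstOrderBessel

/-- The complex Hilbert space `L²((a,b); dx)`. -/
abbrev L2Ioo (a b : ℝ) : Type := Lp ℂ 2 (volume.restrict (Ioo a b))

/-- `f ∈ AC_loc((a,b))`: `f` is absolutely continuous on every compact interval `[c,d] ⊂ (a,b)`. -/
def LocAC (f : ℝ → ℂ) (a b : ℝ) : Prop :=
  ∀ c d : ℝ, a < c → c ≤ d → d < b → AbsolutelyContinuousOnInterval f c d

/-- The differential expression `α_s f = f' - (s + 1/2) f / (x - a)`. -/
noncomputable def alpha (s a : ℝ) (f : ℝ → ℂ) (x : ℝ) : ℂ :=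
  deriv f x - (((s + 1 / 2) / (x - a) : ℝ) : ℂ) * f x

/-- `φ ∈ C_0^∞((a,b))` (extended by zero to the real line). -/
def IsTest (φ : ℝ → ℂ) (a b : ℝ) : Prop :=
  ContDiff ℝ ∞ φ ∧ HasCompactSupport φ ∧ tsupport φ ⊆ Ioo a b

theorem LocAC.add {f g : ℝ → ℂ} {a b : ℝ} (hf : LocAC f a b) (hg : LocAC g a b) :
    LocAC (f + g) a b :=
  fun c d hc hcd hd => (hf c d hc hcd hd).add (hg c d hc hcd hd)

theorem LocAC.const_smul {f : ℝ → ℂ} {a b : ℝ} (k : ℂ) (hf : LocAC f a b) :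
    LocAC (k • f) a b :=
  fun c d hc hcd hd => (hf c d hc hcd hd).const_smul k

theorem LocAC.continuousOn {f : ℝ → ℂ} {a b : ℝ} (hf : LocAC f a b) :
    ContinuousOn f (Ioo a b) := by
  intro x hx
  obtain ⟨c, hac, hcx⟩ := exists_between hx.1
  obtain ⟨d, hxd, hdb⟩ := exists_between hx.2
  have h := (hf c d hac (hcx.trans hxd).le hdb).continuousOn
  rw [uIcc_of_le (hcx.trans hxd).le] at h
  exact (h.continuousAt (Icc_mem_nhds hcx hxd)).continuousWithinAt

theorem LocAC.ae_differentiableAt {f : ℝ → ℂ} {a b : ℝ} (hf : LocAC f a b) :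
    ∀ᵐ x ∂(volume.restrict (Ioo a b)), DifferentiableAt ℝ f x := by
  have key : ∀ q : ℚ × ℚ, ∀ᵐ x : ℝ, a < q.1 → (q.2 : ℝ) < b → (q.1 : ℝ) ≤ q.2 →
      x ∈ uIcc (q.1 : ℝ) q.2 → DifferentiableAt ℝ f x := by
    intro q
    by_cases h : a < q.1 ∧ (q.2 : ℝ) < b ∧ (q.1 : ℝ) ≤ q.2
    · filter_upwards [(hf q.1 q.2 h.1 h.2.2 h.2.1).boundedVariationOn.ae_differentiableAt_of_mem_uIcc]
        with x hx _ _ _ hm using hx hm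
    · exact Eventually.of_forall fun x h1 h2 h3 _ => absurd ⟨h1, h2, h3⟩ h
  rw [ae_restrict_iff' measurableSet_Ioo]
  filter_upwards [ae_all_iff.2 key] with x hx hm
  obtain ⟨c, hac, hcx⟩ := exists_rat_btwn hm.1
  obtain ⟨d, hxd, hdb⟩ := exists_rat_btwn hm.2
  have hcd : (c : ℝ) ≤ d := (hcx.trans hxd).le
  exact hx (c, d) hac hdb hcd (by rw [uIcc_of_le hcd]; exact ⟨hcx.le, hxd.le⟩)

/-- The graph of the maximal operator: all pairs `(f, α_s f)` of elements of `L²((a,b); dx)` with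
`f ∈ AC_loc((a,b))`, i.e. such that the class `f` has a representative `g` in `AC_loc((a,b))`. -/
def maxGraph (s a b : ℝ) : Submodule ℂ (L2Ioo a b × L2Ioo a b) where
  carrier := {p | ∃ g : ℝ → ℂ, LocAC g a b ∧
    p.1 =ᵐ[volume.restrict (Ioo a b)] g ∧ p.2 =ᵐ[volume.restrict (Ioo a b)] alpha s a g}
  zero_mem' := by
    refine ⟨0, fun c d _ _ _ => ?_, Lp.coeFn_zero _ _ _, ?_⟩
    · exact (contDiffOn_const (c := (0 : ℂ)) (s := uIcc c d)
        (𝕜 := ℝ) (n := 1)).absolutelyContinuousOnInterval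
    · filter_upwards [Lp.coeFn_zero ℂ 2 (volume.restrict (Ioo a b))] with x hx
      simp only [Prod.snd_zero]
      rw [hx]
      simp [alpha]
  add_mem' := by
    rintro p q ⟨f, hf, hf1, hf2⟩ ⟨g, hg, hg1, hg2⟩
    refine ⟨f + g, hf.add hg, (Lp.coeFn_add _ _).trans (hf1.add hg1), ?_⟩
    refine (Lp.coeFn_add _ _).trans ((hf2.add hg2).trans ?_)
    filter_upwards [hf.ae_differentiableAt, hg.ae_differentiableAt] with x hx hy
    simp only [Pi.add_apply, alpha, deriv_add hx hy]
    ring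
  smul_mem' := by
    rintro k p ⟨f, hf, hf1, hf2⟩
    refine ⟨k • f, hf.const_smul k, (Lp.coeFn_smul _ _).trans (hf1.const_smul k), ?_⟩
    refine (Lp.coeFn_smul _ _).trans ((hf2.const_smul k).trans ?_)
    filter_upwards [hf.ae_differentiableAt] with x hx
    simp only [Pi.smul_apply, alpha, deriv_const_smul k hx, smul_eq_mul]
    ring

theorem maxGraph_single_valued (s a b : ℝ) (p : L2Ioo a b × L2Ioo a b)
    (hp : p ∈ maxGraph s a b) (h0 : p.1 = 0) : p.2 = 0 := by
  obtain ⟨g, hg, h1, h2⟩ := hp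
  have hz : g =ᵐ[volume.restrict (Ioo a b)] (0 : ℝ → ℂ) := by
    rw [h0] at h1
    exact h1.symm.trans (Lp.coeFn_zero _ _ _)
  have hE : EqOn g 0 (Ioo a b) :=
    Measure.eqOn_open_of_ae_eq hz isOpen_Ioo hg.continuousOn continuousOn_const
  rw [Lp.eq_zero_iff_ae_eq_zero]
  refine h2.trans ?_
  filter_upwards [ae_restrict_mem measurableSet_Ioo] with x hx
  have hev : g =ᶠ[𝓝 x] fun _ => (0 : ℂ) := by
    filter_upwards [isOpen_Ioo.mem_nhds hx] with y hy using hE hy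
  simp [alpha, hev.deriv_eq, hE hx]

/-- The maximal operator `A_{s,max}`. -/
noncomputable def opMax (s a b : ℝ) : L2Ioo a b →ₗ.[ℂ] L2Ioo a b :=
  (maxGraph s a b).toLinearPMap

theorem graph_opMax (s a b : ℝ) : (opMax s a b).graph = maxGraph s a b :=
  Submodule.toLinearPMap_graph_eq _ (maxGraph_single_valued s a b)

/-- The elements of `L²((a,b); dx)` whose support is a compact subset of `(a,b)`. -/
def compactlySupported (a b : ℝ) : Submodule ℂ (L2Ioo a b) where
  carrier := {f | ∃ K : Set ℝ, IsCompact K ∧ K ⊆ Ioo a b ∧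
    ∀ᵐ x ∂(volume.restrict (Ioo a b)), x ∉ K → f x = 0}
  zero_mem' := by
    refine ⟨∅, isCompact_empty, empty_subset _, ?_⟩
    filter_upwards [Lp.coeFn_zero ℂ 2 (volume.restrict (Ioo a b))] with x hx _ using hx
  add_mem' := by
    rintro f g ⟨K, hK, hKs, hf⟩ ⟨L, hL, hLs, hg⟩
    refine ⟨K ∪ L, hK.union hL, union_subset hKs hLs, ?_⟩
    filter_upwards [hf, hg, Lp.coeFn_add f g] with x h1 h2 h3 hx
    rw [h3, Pi.add_apply, h1 fun h => hx (Or.inl h), h2 fun h => hx (Or.inr h), add_zero]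
  smul_mem' := by
    rintro k f ⟨K, hK, hKs, hf⟩
    refine ⟨K, hK, hKs, ?_⟩
    filter_upwards [hf, Lp.coeFn_smul k f] with x h1 h2 hx
    rw [h2, Pi.smul_apply, h1 hx, smul_zero]

/-- The pairs `(φ, φ')`, `φ ∈ C_0^∞((a,b))`, in `L²((a,b); dx) × L²((a,b); dx)`. -/
def testGraph (a b : ℝ) : Submodule ℂ (L2Ioo a b × L2Ioo a b) where
  carrier := {p | ∃ φ : ℝ → ℂ, IsTest φ a b ∧
    p.1 =ᵐ[volume.restrict (Ioo a b)] φ ∧ p.2 =ᵐ[volume.restrict (Ioo a b)] deriv φ}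
  zero_mem' := by
    refine ⟨0, ⟨contDiff_const, HasCompactSupport.zero, by simp [tsupport]⟩,
      Lp.coeFn_zero _ _ _, ?_⟩
    simpa using Lp.coeFn_zero ℂ 2 (volume.restrict (Ioo a b))
  add_mem' := by
    rintro p q ⟨f, ⟨hf, hfc, hfs⟩, hf1, hf2⟩ ⟨g, ⟨hg, hgc, hgs⟩, hg1, hg2⟩
    refine ⟨f + g, ⟨hf.add hg, hfc.add hgc, (tsupport_add f g).trans (union_subset hfs hgs)⟩,
      (Lp.coeFn_add _ _).trans (hf1.add hg1), ?_⟩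
    refine (Lp.coeFn_add _ _).trans ((hf2.add hg2).trans (Eventually.of_forall fun x => ?_))
    simp only [Pi.add_apply]
    rw [deriv_add (hf.differentiable (by simp) x) (hg.differentiable (by simp) x)]
  smul_mem' := by
    rintro k p ⟨f, ⟨hf, hfc, hfs⟩, hf1, hf2⟩
    refine ⟨k • f, ⟨hf.const_smul k, hfc.smul_left (f := fun _ => k),
      (tsupport_smul_subset_right (fun _ => k) f).trans hfs⟩,
      (Lp.coeFn_smul _ _).trans (hf1.const_smul k), ?_⟩
    refine (Lp.coeFn_smul _ _).trans ((hf2.const_smul k).trans (Eventually.of_forall fun x => ?_))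
    simp only [Pi.smul_apply]
    rw [deriv_const_smul k (hf.differentiable (by simp) x)]

/-- `C_0^∞((a,b))` as a subspace of `L²((a,b); dx)`. -/
noncomputable def testSpace (a b : ℝ) : Submodule ℂ (L2Ioo a b) :=
  (testGraph a b).map (LinearMap.fst ℂ (L2Ioo a b) (L2Ioo a b))

/-- `H_0^1((a,b))`, the completion of `C_0^∞((a,b))` in the norm of `H^1((a,b))`, as a subspace of
`L²((a,b); dx)`: it consists of the `f` for which there are `φ_n ∈ C_0^∞((a,b))` such that
`φ_n → f` and `φ_n'` converges in `L²((a,b); dx)`. -/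
noncomputable def H01 (a b : ℝ) : Submodule ℂ (L2Ioo a b) :=
  (testGraph a b).topologicalClosure.map (LinearMap.fst ℂ (L2Ioo a b) (L2Ioo a b))

/-- The preminimal operator: the restriction of `A_{s,max}` to the functions in its domain whose
support is a compact subset of `(a,b)`. -/
noncomputable def opPreMin (s a b : ℝ) : L2Ioo a b →ₗ.[ℂ] L2Ioo a b :=
  (opMax s a b).domRestrict (compactlySupported a b)

/-- The restriction of `α_s` to `C_0^∞((a,b))`. -/
noncomputable def opSmooth (s a b : ℝ) : L2Ioo a b →ₗ.[ℂ] L2Ioo a b :=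
  (opMax s a b).domRestrict (testSpace a b)

/-- The minimal operator `A_{s,min}`: the closure of the preminimal operator. -/
noncomputable def opMin (s a b : ℝ) : L2Ioo a b →ₗ.[ℂ] L2Ioo a b :=
  (opPreMin s a b).closure

/-- `{f ∈ L²((a,b); dx) | f ∈ AC_loc((a,b)); f satisfies P; α_s f ∈ L²((a,b); dx)}`, where `P` is
imposed on the locally absolutely continuous representative of `f`. -/
def acDomain (s a b : ℝ) (P : (ℝ → ℂ) → Prop) : Set (L2Ioo a b) :=
  {f | ∃ g : ℝ → ℂ, LocAC g a b ∧ f =ᵐ[volume.restrict (Ioo a b)] g ∧ P g ∧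
    MemLp (alpha s a g) 2 (volume.restrict (Ioo a b))}

/-- The boundary condition `f(a) = 0`, i.e. `lim_{x ↓ a} f(x) = 0`. -/
def VanishesLeft (a : ℝ) (f : ℝ → ℂ) : Prop := Tendsto f (𝓝[>] a) (𝓝 0)

/-- The boundary condition `f(b) = 0`, i.e. `lim_{x ↑ b} f(x) = 0`. -/
def VanishesRight (b : ℝ) (f : ℝ → ℂ) : Prop := Tendsto f (𝓝[<] b) (𝓝 0)

/-- `lim_{x ↓ a} f(x) / (x - a)^{1/2} = 0`. -/
def SqrtVanishesLeft (a : ℝ) (f : ℝ → ℂ) : Prop :=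
  Tendsto (fun x => f x / ((Real.sqrt (x - a) : ℝ) : ℂ)) (𝓝[>] a) (𝓝 0)

/-- `lim_{x ↑ b} f(x) / (b - x)^{1/2} = 0`. -/
def SqrtVanishesRight (b : ℝ) (f : ℝ → ℂ) : Prop :=
  Tendsto (fun x => f x / ((Real.sqrt (b - x) : ℝ) : ℂ)) (𝓝[<] b) (𝓝 0)

/-- `lim_{x ↓ a} f(x) / [(x - a) ln(R / (x - a))]^{1/2} = 0`; the bracket is positive for
`a < x < a + R`. -/
def LogSqrtVanishesLeft (R a : ℝ) (f : ℝ → ℂ) : Prop :=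
  Tendsto (fun x => f x / ((Real.sqrt ((x - a) * Real.log (R / (x - a))) : ℝ) : ℂ))
    (𝓝[>] a) (𝓝 0)

end FirstOrderBessel

open FirstOrderBessel

namespace FirstOrderBessel

/-! ### Absolutely continuous solutions of the first order equation -/

/-! Put `h = s + 1/2`. The integrating factor `w = (x - a)^(-h)` turns `α_s g = G` into `(w g)' = w
G`, so `g = (x - a)^h (C + ∫_m^x w G)`. Everything at the level of a single function is read off
this formula (`powC_mul_sub_eq_integral`, `eqOn_solution`). It shows that the maximal operator is
closed, and Cauchy–Schwarz applied to the integral gives the boundary behaviour. Since `w ∈ L²`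
exactly when `s < 0`, there are three regimes at `a`. For `s > 0` one integrates from the right and
gains `(x - a)^(1/2)`; for `s = 0` the same computation costs a logarithm; for `s < 0` one
integrates from `a`, leaving a multiple of the homogeneous solution `(x - a)^h`, which is not in
`L²` and hence absent when `s ≤ -1`. At `b` the coefficient is regular, so vanishing there improves
to `o((b - x)^(1/2))`.

The equality of the closures is a density statement about ranges. By a du Bois-Reymond argument, a
vector orthogonal to `α_s C_0^∞` is the conjugate of a multiple of `w` (`mem_closure_testRange`), so
the closed range is `w̄^⊥` if `s < 0` and all of `L²` otherwise. An a priori bound `‖f‖ ≤ K ‖α_s f‖`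
lifts convergence in the range to convergence in the graph (`mem_closure_graph_opSmooth`). For `s =
0` the bound holds for all functions vanishing at `b`, which identifies the minimal domain
(`domain_opMin_zero`).

For `s ≠ 0` the identity `2 Re ⟪φ/(x - a), φ'⟫ = ‖φ/(x - a)‖²` bounds `φ/(x - a)` both by `2 ‖φ'‖`
and by `|s|⁻¹ ‖α_s φ‖`. The graph norm of `α_s` is therefore equivalent to the `H¹` norm on test
functions (`domain_opMin_eq_H01`). It also shows `f/(x - a) ∈ L²` for `f ∈ H_0^1`, which explicit
powers of `x - a` violate; this gives the strict inclusions. -/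

theorem _root_.AbsolutelyContinuousOnInterval.congr {X : Type*} [PseudoMetricSpace X]
    {f g : ℝ → X} {c d : ℝ} (hf : AbsolutelyContinuousOnInterval f c d)
    (hfg : EqOn f g (uIcc c d)) : AbsolutelyContinuousOnInterval g c d := by
  rw [absolutelyContinuousOnInterval_iff] at hf ⊢
  intro ε hε
  obtain ⟨δ, hδ, h⟩ := hf ε hε
  refine ⟨δ, hδ, fun E hE hlt => ?_⟩
  have := h E hE hlt
  rwa [Finset.sum_congr rfl fun i hi => ?_] at this
  rw [hfg (hE.1 i hi).1, hfg (hE.1 i hi).2]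

theorem _root_.AbsolutelyContinuousOnInterval.ofReal {f : ℝ → ℝ} {c d : ℝ}
    (hf : AbsolutelyContinuousOnInterval f c d) :
    AbsolutelyContinuousOnInterval (fun x => (f x : ℂ)) c d := by
  have h1 : AbsolutelyContinuousOnInterval (fun _ : ℝ => (1 : ℂ)) c d :=
    (contDiffOn_const (𝕜 := ℝ) (n := 1)).absolutelyContinuousOnInterval
  refine (hf.smul h1).congr fun x _ => ?_
  simp

theorem _root_.IntervalIntegrable.absolutelyContinuousOnInterval_primitive {f : ℝ → ℂ}
    {c d m : ℝ} (h : IntervalIntegrable f volume c d) (hm : m ∈ uIcc c d) :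
    AbsolutelyContinuousOnInterval (fun x => ∫ t in m..x, f t) c d := by
  have hr : IntervalIntegrable (fun x => (f x).re) volume c d := ⟨h.1.re, h.2.re⟩
  have hi : IntervalIntegrable (fun x => (f x).im) volume c d := ⟨h.1.im, h.2.im⟩
  refine ((hr.absolutelyContinuousOnInterval_intervalIntegral hm).ofReal.add
    ((hi.absolutelyContinuousOnInterval_intervalIntegral hm).ofReal.const_smul Complex.I)).congr
    fun x hx => ?_
  have hf : IntervalIntegrable f volume m x := h.mono_set (uIcc_subset_uIcc hm hx)
  simp only [Pi.add_apply, smul_eq_mul]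
  apply Complex.ext
  · simpa using (Complex.reCLM.intervalIntegral_comp_comm hf)
  · simpa using (Complex.imCLM.intervalIntegral_comp_comm hf)

/-- The real power `(x - a) ^ r`, as a complex number. -/
noncomputable def powC (a r x : ℝ) : ℂ := (((x - a) ^ r : ℝ) : ℂ)

theorem powC_ne_zero {a r x : ℝ} (hx : a < x) : powC a r x ≠ 0 :=
  Complex.ofReal_ne_zero.2 (Real.rpow_pos_of_pos (sub_pos.2 hx) r).ne'

theorem norm_powC {a r x : ℝ} (hx : a < x) : ‖powC a r x‖ = (x - a) ^ r := by
  rw [powC, Complex.norm_real, Real.norm_of_nonneg (Real.rpow_nonneg (sub_pos.2 hx).le r)]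

theorem powC_neg_mul {a r x : ℝ} (hx : a < x) : powC a (-r) x * powC a r x = 1 := by
  rw [powC, powC, ← Complex.ofReal_mul, Real.rpow_neg (sub_pos.2 hx).le,
    inv_mul_cancel₀ (Real.rpow_pos_of_pos (sub_pos.2 hx) r).ne', Complex.ofReal_one]

theorem powC_mul_neg {a r x : ℝ} (hx : a < x) : powC a r x * powC a (-r) x = 1 := by
  rw [mul_comm, powC_neg_mul hx]

theorem hasDerivAt_powC {a r x : ℝ} (hx : a < x) :
    HasDerivAt (powC a r) (((r / (x - a) : ℝ) : ℂ) * powC a r x) x := by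
  have h0 : x - a ≠ 0 := (sub_pos.2 hx).ne'
  have h := ((Real.hasDerivAt_rpow_const (p := r) (Or.inl h0)).comp x
    ((hasDerivAt_id x).sub_const a)).ofReal_comp
  convert! h using 1
  rw [powC, Real.rpow_sub_one h0]
  push_cast
  ring

theorem contDiffOn_powC (a r : ℝ) {n : WithTop ℕ∞} : ContDiffOn ℝ n (powC a r) (Ioi a) := by
  have : ContDiffOn ℝ n (fun x : ℝ => (x - a) ^ r) (Ioi a) := fun x hx =>
    ((contDiffAt_id.sub contDiffAt_const).rpow_const_of_ne
      (sub_pos.2 hx).ne').contDiffWithinAt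
  exact Complex.ofRealCLM.contDiff.comp_contDiffOn this

theorem continuousOn_powC (a r : ℝ) : ContinuousOn (powC a r) (Ioi a) :=
  (contDiffOn_powC a r (n := 0)).continuousOn

theorem absolutelyContinuousOnInterval_powC {a c d : ℝ} (r : ℝ) (hc : a < c) (hd : a < d) :
    AbsolutelyContinuousOnInterval (powC a r) c d :=
  ((contDiffOn_powC a r).mono fun _ hx =>
    (lt_min hc hd).trans_le hx.1).absolutelyContinuousOnInterval

variable {a b : ℝ} {G : ℝ → ℂ}

theorem memLp_intervalIntegrable (hG : MemLp G 2 (volume.restrict (Ioo a b))) {x y : ℝ}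
    (hx : x ∈ Icc a b) (hy : y ∈ Icc a b) : IntervalIntegrable G volume x y := by
  have h1 : IntegrableOn G (Ioo a b) := hG.integrable (by norm_num)
  rw [← integrableOn_Icc_iff_integrableOn_Ioo] at h1
  exact (h1.mono_set (uIcc_subset_Icc hx hy) : IntegrableOn G (uIcc x y)).intervalIntegrable

theorem intervalIntegrable_powC_mul (hG : MemLp G 2 (volume.restrict (Ioo a b))) (r : ℝ)
    {x y : ℝ} (hx : x ∈ Ioc a b) (hy : y ∈ Ioc a b) :
    IntervalIntegrable (fun t => powC a r t * G t) volume x y :=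
  (memLp_intervalIntegrable hG (Ioc_subset_Icc_self hx)
    (Ioc_subset_Icc_self hy)).continuousOn_mul
    ((continuousOn_powC a r).mono fun _ ht => (lt_min hx.1 hy.1).trans_le ht.1)

/-- The function `(x - a) ^ h * (C + ∫ t in m..x, (t - a) ^ (-h) * G t)`. -/
noncomputable def solution (a h m : ℝ) (C : ℂ) (G : ℝ → ℂ) (x : ℝ) : ℂ :=
  powC a h x * (C + ∫ t in m..x, powC a (-h) t * G t)

/-- Countably many compact intervals with rational end points exhaust `(a, b)`, so their null sets
can be merged. -/
theorem ae_restrict_Ioo_of_forall_Icc {p : ℝ → Prop}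
    (h : ∀ c d : ℝ, a < c → c ≤ d → d < b → ∀ᵐ x : ℝ, x ∈ uIcc c d → p x) :
    ∀ᵐ x ∂(volume.restrict (Ioo a b)), p x := by
  have key : ∀ q : ℚ × ℚ, ∀ᵐ x : ℝ, a < q.1 → (q.2 : ℝ) < b → (q.1 : ℝ) ≤ q.2 →
      x ∈ uIcc (q.1 : ℝ) q.2 → p x := by
    intro q
    by_cases hq : a < q.1 ∧ (q.2 : ℝ) < b ∧ (q.1 : ℝ) ≤ q.2
    · filter_upwards [h q.1 q.2 hq.1 hq.2.2 hq.2.1] with x hx _ _ _ hm using hx hm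
    · exact Eventually.of_forall fun x h1 h2 h3 _ => absurd ⟨h1, h2, h3⟩ hq
  rw [ae_restrict_iff' measurableSet_Ioo]
  filter_upwards [ae_all_iff.2 key] with x hx hm
  obtain ⟨c, hac, hcx⟩ := exists_rat_btwn hm.1
  obtain ⟨d, hxd, hdb⟩ := exists_rat_btwn hm.2
  have hcd : (c : ℝ) ≤ d := (hcx.trans hxd).le
  exact hx (c, d) hac hdb hcd (by rw [uIcc_of_le hcd]; exact ⟨hcx.le, hxd.le⟩)

theorem LocAC.congr {f g : ℝ → ℂ} (hf : LocAC f a b) (hfg : EqOn f g (Ioo a b)) :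
    LocAC g a b := fun c d hc hcd hd => (hf c d hc hcd hd).congr <| by
  rw [uIcc_of_le hcd]
  exact hfg.mono (Icc_subset_Ioo hc hd)

theorem alpha_congr {f g : ℝ → ℂ} (s : ℝ) (hfg : EqOn f g (Ioo a b)) :
    EqOn (alpha s a f) (alpha s a g) (Ioo a b) := fun x hx => by
  have : f =ᶠ[𝓝 x] g := by
    filter_upwards [isOpen_Ioo.mem_nhds hx] with y hy using hfg hy
  rw [alpha, alpha, this.deriv_eq, hfg hx]

theorem locAC_solution (hG : MemLp G 2 (volume.restrict (Ioo a b))) {m : ℝ} (hm : m ∈ Ioc a b)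
    (h : ℝ) (C : ℂ) : LocAC (solution a h m C G) a b := by
  intro c d hc hcd hd
  have hb : b ∈ Ioc a b := ⟨hc.trans (hcd.trans_lt hd), le_rfl⟩
  -- The interval `[c ⊓ m, b]` contains both `[c, d]` and the base point `m`, which may lie outside
  -- `[c, d]` and may equal `b`.
  have hc' : c ⊓ m ∈ Ioc a b := ⟨lt_min hc hm.1, inf_le_right.trans hm.2⟩
  have h1 := (intervalIntegrable_powC_mul hG (-h) hc'
    hb).absolutelyContinuousOnInterval_primitive (m := m)
      (by rw [uIcc_of_le hc'.2]; exact ⟨inf_le_right, hm.2⟩)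
  have h2 : AbsolutelyContinuousOnInterval (fun _ : ℝ => C) c d :=
    (contDiffOn_const (𝕜 := ℝ) (n := 1)).absolutelyContinuousOnInterval
  refine (absolutelyContinuousOnInterval_powC h hc (hc.trans_le hcd)).smul
    (h2.add (h1.mono ?_))
  rw [uIcc_of_le hcd, uIcc_of_le hc'.2]
  exact Icc_subset_Icc inf_le_left hd.le

theorem alpha_solution (hG : MemLp G 2 (volume.restrict (Ioo a b))) {m : ℝ} (hm : m ∈ Ioc a b)
    (s : ℝ) (C : ℂ) :
    alpha s a (solution a (s + 1 / 2) m C G) =ᵐ[volume.restrict (Ioo a b)] G := by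
  refine ae_restrict_Ioo_of_forall_Icc fun c d hc hcd hd => ?_
  have hb : b ∈ Ioc a b := ⟨hc.trans (hcd.trans_lt hd), le_rfl⟩
  have hc' : c ⊓ m ∈ Ioc a b := ⟨lt_min hc hm.1, inf_le_right.trans hm.2⟩
  filter_upwards [(intervalIntegrable_powC_mul hG (-(s + 1 / 2)) hc'
    hb).ae_hasDerivAt_integral] with x hx hxm
  rw [uIcc_of_le hcd] at hxm
  have hax : a < x := hc.trans_le hxm.1
  rw [uIcc_of_le hc'.2] at hx
  have h1 := hx ⟨inf_le_left.trans hxm.1, hxm.2.trans hd.le⟩ m ⟨inf_le_right, hm.2⟩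
  have h2 := (hasDerivAt_powC (r := s + 1 / 2) hax).mul (h1.const_add C)
  rw [alpha, show deriv (solution a (s + 1 / 2) m C G) x = _ from h2.deriv, solution,
    ← mul_assoc, powC_mul_neg hax]
  ring

/-- The fundamental theorem of calculus for the differential expression `alpha s a`. -/
theorem powC_mul_sub_eq_integral {s : ℝ} {g : ℝ → ℂ} (hg : LocAC g a b)
    (hG : MemLp G 2 (volume.restrict (Ioo a b)))
    (hgG : G =ᵐ[volume.restrict (Ioo a b)] alpha s a g) {x y : ℝ} (hx : x ∈ Ioo a b)
    (hy : y ∈ Ioo a b) :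
    powC a (-(s + 1 / 2)) y * g y - powC a (-(s + 1 / 2)) x * g x =
      ∫ t in x..y, powC a (-(s + 1 / 2)) t * G t := by
  wlog hxy : x ≤ y generalizing x y
  · rw [intervalIntegral.integral_symm, ← this hy hx (not_le.1 hxy).le]
    ring
  set r := -(s + 1 / 2) with hr
  have hI := intervalIntegrable_powC_mul hG r (Ioo_subset_Ioc_self hx) (Ioo_subset_Ioc_self hy)
  -- The difference of `(t - a)^r g` and the primitive of `(t - a)^r G` is absolutely continuous
  -- with derivative zero almost everywhere, hence constant.
  have hac := ((absolutelyContinuousOnInterval_powC r hx.1 hy.1).smul (hg x y hx.1 hxy hy.2)).sub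
    (hI.absolutelyContinuousOnInterval_primitive left_mem_uIcc)
  have hd := hg.ae_differentiableAt
  rw [EventuallyEq, ae_restrict_iff' measurableSet_Ioo] at hgG
  rw [ae_restrict_iff' measurableSet_Ioo] at hd
  obtain ⟨C, hC⟩ := hac.const_of_ae_hasDerivAt_zero (by
    filter_upwards [hI.ae_hasDerivAt_integral, hgG, hd] with t h1 h2 h3 ht
    have h1 := h1 ht x left_mem_uIcc
    rw [uIcc_of_le hxy] at ht
    have ht' : t ∈ Ioo a b := ⟨hx.1.trans_le ht.1, ht.2.trans_lt hy.2⟩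
    have h4 := ((hasDerivAt_powC (r := r) ht'.1).mul (h3 ht').hasDerivAt).sub h1
    convert! h4 using 1
    rw [h2 ht', alpha, hr]
    push_cast
    ring)
  have h1 := hC x left_mem_uIcc
  have h2 := hC y right_mem_uIcc
  simp only [Pi.sub_apply, Pi.mul_apply, smul_eq_mul, intervalIntegral.integral_same,
    sub_zero] at h1 h2
  rw [h1, ← h2]
  ring

theorem eqOn_solution {s : ℝ} {g : ℝ → ℂ} (hg : LocAC g a b)
    (hG : MemLp G 2 (volume.restrict (Ioo a b)))
    (hgG : G =ᵐ[volume.restrict (Ioo a b)] alpha s a g) {m : ℝ} (hm : m ∈ Ioo a b) :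
    EqOn g (solution a (s + 1 / 2) m (powC a (-(s + 1 / 2)) m * g m) G) (Ioo a b) := by
  intro x hx
  rw [solution, ← powC_mul_sub_eq_integral hg hG hgG hm hx, add_sub_cancel, ← mul_assoc,
    powC_mul_neg hx.1, one_mul]

end FirstOrderBessel

namespace FirstOrderBessel

/-! ### Closedness of the maximal operator -/

/-! ### Almost everywhere limits and weighted integrals along `L²` convergence. -/

section Lp
variable {α : Type*} [MeasurableSpace α] {μ : Measure α}

theorem exists_subseq_ae_tendsto {u : ℕ → Lp ℂ 2 μ} {f : Lp ℂ 2 μ}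
    (hu : Tendsto u atTop (𝓝 f)) :
    ∃ n : ℕ → ℕ, StrictMono n ∧ ∀ᵐ x ∂μ, Tendsto (fun i => u (n i) x) atTop (𝓝 (f x)) :=
  (tendstoInMeasure_of_tendsto_Lp hu).exists_seq_tendsto_ae

theorem ae_eq_of_tendsto_of_ae_tendsto {u : ℕ → Lp ℂ 2 μ} {f : Lp ℂ 2 μ}
    (hu : Tendsto u atTop (𝓝 f)) {r : α → ℂ}
    (h : ∀ᵐ x ∂μ, Tendsto (fun n => u n x) atTop (𝓝 (r x))) : f =ᵐ[μ] r := by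
  obtain ⟨n, hn, hf⟩ := exists_subseq_ae_tendsto hu
  filter_upwards [h, hf] with x h1 h2
  exact tendsto_nhds_unique h2 (h1.comp hn.tendsto_atTop)

/-- Conjugating the weight turns the bilinear pairing into an inner product, so its continuity in
`F` is automatic. -/
theorem inner_star_toLp {k : α → ℂ} (hk : MemLp k 2 μ) (F : Lp ℂ 2 μ) :
    inner ℂ hk.star.toLp F = ∫ x, k x * F x ∂μ := by
  rw [L2.inner_def]
  refine integral_congr_ae ?_
  filter_upwards [hk.star.coeFn_toLp] with x hx
  rw [hx]
  simp [mul_comm]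

theorem tendsto_integral_mul {k : α → ℂ} (hk : MemLp k 2 μ) {u : ℕ → Lp ℂ 2 μ}
    {F : Lp ℂ 2 μ} (hu : Tendsto u atTop (𝓝 F)) :
    Tendsto (fun n => ∫ x, k x * u n x ∂μ) atTop (𝓝 (∫ x, k x * F x ∂μ)) := by
  simp only [← inner_star_toLp hk]
  exact tendsto_const_nhds.inner hu

end Lp

variable {a b : ℝ}

theorem intervalIntegral_eq_integral_indicator {x y : ℝ} (hxy : x ≤ y) (hx : a ≤ x) (hy : y ≤ b)
    (k F : ℝ → ℂ) : ∫ t in x..y, k t * F t =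
      ∫ t in Ioo a b, (Ioo x y).indicator k t * F t := by
  have : (fun t => (Ioo x y).indicator k t * F t) = (Ioo x y).indicator fun t => k t * F t := by
    ext t
    by_cases ht : t ∈ Ioo x y <;> simp [ht]
  rw [this, setIntegral_indicator measurableSet_Ioo, intervalIntegral.integral_of_le hxy,
    integral_Ioc_eq_integral_Ioo, inter_eq_self_of_subset_right (Ioo_subset_Ioo hx hy)]

theorem tendsto_intervalIntegral_mul {k : ℝ → ℂ} {x y : ℝ} (hxy : x ≤ y) (hx : a ≤ x)
    (hy : y ≤ b) (hk : MemLp k 2 (volume.restrict (Ioo x y))) {u : ℕ → L2Ioo a b} {F : L2Ioo a b}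
    (hu : Tendsto u atTop (𝓝 F)) :
    Tendsto (fun n => ∫ t in x..y, k t * u n t) atTop (𝓝 (∫ t in x..y, k t * F t)) := by
  simp only [intervalIntegral_eq_integral_indicator hxy hx hy]
  refine tendsto_integral_mul ?_ hu
  rw [memLp_indicator_iff_restrict measurableSet_Ioo, Measure.restrict_restrict measurableSet_Ioo,
    inter_eq_self_of_subset_left (Ioo_subset_Ioo hx hy)]
  exact hk

theorem _root_.ContinuousOn.memLp_Ioo {k : ℝ → ℂ} {x y : ℝ} (hk : ContinuousOn k (Icc x y)) :
    MemLp k 2 (volume.restrict (Ioo x y)) := by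
  obtain ⟨C, hC⟩ := isCompact_Icc.exists_bound_of_continuousOn hk
  refine MemLp.of_bound ((hk.mono Ioo_subset_Icc_self).aestronglyMeasurable measurableSet_Ioo) C ?_
  filter_upwards [ae_restrict_mem measurableSet_Ioo] with t ht using hC t (Ioo_subset_Icc_self ht)

theorem tendsto_intervalIntegral_powC_mul {x y : ℝ} (hx : x ∈ Ioc a b) (hy : y ∈ Ioc a b) (r : ℝ)
    {u : ℕ → L2Ioo a b} {F : L2Ioo a b} (hu : Tendsto u atTop (𝓝 F)) :
    Tendsto (fun n => ∫ t in x..y, powC a r t * u n t) atTop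
      (𝓝 (∫ t in x..y, powC a r t * F t)) := by
  wlog hxy : x ≤ y generalizing x y
  · simp only [intervalIntegral.integral_symm y x]
    exact (this hy hx (not_le.1 hxy).le).neg
  refine tendsto_intervalIntegral_mul hxy hx.1.le hy.2 (ContinuousOn.memLp_Ioo ?_) hu
  exact (continuousOn_powC a r).mono fun t ht => hx.1.trans_le ht.1

theorem mem_maxGraph_of_ae_eq_solution {s m : ℝ} (hm : m ∈ Ioc a b) {p : L2Ioo a b × L2Ioo a b}
    {C : ℂ} (h : p.1 =ᵐ[volume.restrict (Ioo a b)] solution a (s + 1 / 2) m C p.2) :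
    p ∈ maxGraph s a b :=
  ⟨_, locAC_solution (Lp.memLp p.2) hm _ C, h, (alpha_solution (Lp.memLp p.2) hm s C).symm⟩

theorem ae_eq_solution_of_mem_maxGraph {s m : ℝ} (hm : m ∈ Ioo a b) {p : L2Ioo a b × L2Ioo a b}
    (h : p ∈ maxGraph s a b) :
    ∃ C, p.1 =ᵐ[volume.restrict (Ioo a b)] solution a (s + 1 / 2) m C p.2 := by
  obtain ⟨g, hg, h1, h2⟩ := h
  refine ⟨powC a (-(s + 1 / 2)) m * g m, h1.trans ?_⟩
  filter_upwards [ae_restrict_mem measurableSet_Ioo] with x hx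
  exact eqOn_solution hg (Lp.memLp p.2) h2 hm hx

/-- The integral term of the solution formula depends continuously on `G ∈ L²` at each fixed `x`, so
the formula survives the limit as soon as the constants converge. -/
theorem isClosed_maxGraph (s : ℝ) (hab : a < b) :
    IsClosed (maxGraph s a b : Set (L2Ioo a b × L2Ioo a b)) := by
  refine IsSeqClosed.isClosed fun u p hu hup => ?_
  obtain ⟨m, hm⟩ : (Ioo a b).Nonempty := nonempty_Ioo.2 hab
  choose C hC using fun n => ae_eq_solution_of_mem_maxGraph hm (hu n)
  obtain ⟨n, hn, hae⟩ := exists_subseq_ae_tendsto ((continuous_fst.tendsto p).comp hup)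
  have h2 : Tendsto (fun n => (u n).2) atTop (𝓝 p.2) := (continuous_snd.tendsto p).comp hup
  have hF : ∀ x ∈ Ioo a b, Tendsto (fun i => ∫ t in m..x, powC a (-(s + 1 / 2)) t * (u (n i)).2 t)
      atTop (𝓝 (∫ t in m..x, powC a (-(s + 1 / 2)) t * p.2 t)) := fun x hx =>
    tendsto_intervalIntegral_powC_mul (Ioo_subset_Ioc_self hm) (Ioo_subset_Ioc_self hx) _
      (h2.comp hn.tendsto_atTop)
  -- At a single point where the subsequence converges, every other term of the formula converges,
  -- and so the constants do.
  obtain ⟨c, hc⟩ : ∃ c, Tendsto (fun i => C (n i)) atTop (𝓝 c) := by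
    have : NeBot (ae (volume.restrict (Ioo a b))) := by
      rw [ae_neBot, Ne, Measure.restrict_eq_zero]
      simp [hab]
    obtain ⟨x, hx, hxm, hCx⟩ := (hae.and ((ae_restrict_mem measurableSet_Ioo).and
      (ae_all_iff.2 hC))).exists
    refine ⟨_, ((hx.const_mul (powC a (-(s + 1 / 2)) x)).sub (hF x hxm)).congr fun i => ?_⟩
    simp only [Function.comp_apply]
    rw [hCx, solution, ← mul_assoc, powC_neg_mul hxm.1]
    ring
  refine mem_maxGraph_of_ae_eq_solution (m := m) (C := c) (Ioo_subset_Ioc_self hm) ?_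
  filter_upwards [hae, ae_restrict_mem measurableSet_Ioo, ae_all_iff.2 hC] with x hx hxm hCx
  refine tendsto_nhds_unique hx ?_
  simp only [Function.comp_apply, hCx]
  exact (hc.add (hF x hxm)).const_mul _

theorem isClosed_opMax (s : ℝ) (hab : a < b) : (opMax s a b).IsClosed := by
  rw [LinearPMap.IsClosed, graph_opMax]
  exact isClosed_maxGraph s hab

theorem mem_graph_domRestrict {R E F : Type*} [Ring R] [AddCommGroup E] [Module R E]
    [AddCommGroup F] [Module R F] {f : E →ₗ.[R] F} {S : Submodule R E} {p : E × F} :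
    p ∈ (f.domRestrict S).graph ↔ p ∈ f.graph ∧ p.1 ∈ S := by
  constructor
  · intro h
    refine ⟨LinearPMap.le_graph_of_le LinearPMap.domRestrict_le h, ?_⟩
    exact (LinearPMap.mem_domain_of_mem_graph h).1
  · rintro ⟨h, hS⟩
    rw [LinearPMap.mem_graph_iff] at h ⊢
    obtain ⟨y, hy1, hy2⟩ := h
    exact ⟨⟨p.1, hS, hy1 ▸ y.2⟩, rfl, (LinearPMap.domRestrict_apply hy1.symm).trans hy2⟩

theorem isClosable_domRestrict (s : ℝ) (hab : a < b) (S : Submodule ℂ (L2Ioo a b)) :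
    ((opMax s a b).domRestrict S).IsClosable :=
  (isClosed_opMax s hab).isClosable.leIsClosable LinearPMap.domRestrict_le

theorem mem_graph_opPreMin {s : ℝ} {p : L2Ioo a b × L2Ioo a b} :
    p ∈ (opPreMin s a b).graph ↔ p ∈ maxGraph s a b ∧ p.1 ∈ compactlySupported a b := by
  rw [opPreMin, mem_graph_domRestrict, graph_opMax]

theorem eqOn_of_ae_eq {f g : ℝ → ℂ} (hf : ContinuousOn f (Ioo a b)) (hg : ContinuousOn g (Ioo a b))
    (h : f =ᵐ[volume.restrict (Ioo a b)] g) : EqOn f g (Ioo a b) :=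
  Measure.eqOn_open_of_ae_eq h isOpen_Ioo hf hg

theorem IsTest.locAC {φ : ℝ → ℂ} (hφ : IsTest φ a b) : LocAC φ a b := fun _ _ _ _ _ =>
  (hφ.1.of_le (by simp)).contDiffOn.absolutelyContinuousOnInterval

theorem mem_graph_opSmooth {s : ℝ} {p : L2Ioo a b × L2Ioo a b} :
    p ∈ (opSmooth s a b).graph ↔ ∃ φ, IsTest φ a b ∧
      p.1 =ᵐ[volume.restrict (Ioo a b)] φ ∧ p.2 =ᵐ[volume.restrict (Ioo a b)] alpha s a φ := by
  rw [opSmooth, mem_graph_domRestrict, graph_opMax]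
  constructor
  · rintro ⟨⟨g, hg, h1, h2⟩, ⟨q, ⟨φ, hφ, hq, -⟩, hqp⟩⟩
    replace hqp : q.1 = p.1 := hqp
    rw [hqp] at hq
    refine ⟨φ, hφ, hq, h2.trans ?_⟩
    have := alpha_congr s (eqOn_of_ae_eq hg.continuousOn hφ.1.continuous.continuousOn
      (h1.symm.trans hq))
    filter_upwards [ae_restrict_mem measurableSet_Ioo] with x hx using this hx
  · rintro ⟨φ, hφ, h1, h2⟩
    have hd : MemLp (deriv φ) 2 (volume.restrict (Ioo a b)) :=
      ((hφ.1.continuous_deriv (by simp)).continuousOn).memLp_Ioo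
    exact ⟨⟨φ, hφ.locAC, h1, h2⟩, ⟨(p.1, hd.toLp), ⟨φ, hφ, h1, hd.coeFn_toLp⟩, rfl⟩⟩

/-- A compact subset of an open interval is contained in a compact subinterval. -/
theorem _root_.IsCompact.exists_subset_Icc_of_subset_Ioo {K : Set ℝ} (hK : IsCompact K)
    (hKs : K ⊆ Ioo a b) (hab : a < b) : ∃ c d, a < c ∧ c ≤ d ∧ d < b ∧ K ⊆ Icc c d := by
  rcases K.eq_empty_or_nonempty with rfl | hne
  · obtain ⟨c, hc⟩ := exists_between hab
    exact ⟨c, c, hc.1, le_rfl, hc.2, empty_subset _⟩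
  · have h1 := hKs (hK.sInf_mem hne)
    have h2 := hKs (hK.sSup_mem hne)
    exact ⟨sInf K, sSup K, h1.1, csInf_le_csSup hne hK.bddBelow hK.bddAbove, h2.2,
      fun x hx => ⟨csInf_le hK.bddBelow hx, le_csSup hK.bddAbove hx⟩⟩

theorem opSmooth_graph_le_opPreMin_graph (s : ℝ) :
    (opSmooth s a b).graph ≤ (opPreMin s a b).graph := by
  intro p hp
  have hp' := hp
  rw [opSmooth, mem_graph_domRestrict, graph_opMax] at hp'
  obtain ⟨φ, hφ, h1, -⟩ := mem_graph_opSmooth.1 hp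
  refine mem_graph_opPreMin.2 ⟨hp'.1, tsupport φ, hφ.2.1, hφ.2.2, ?_⟩
  filter_upwards [h1] with x hx hxs
  rw [hx, image_eq_zero_of_notMem_tsupport hxs]

/-- A continuous function that vanishes almost everywhere on an open set vanishes at every point of
it. -/
theorem eqOn_zero_of_compactlySupported {f : L2Ioo a b} (hf : f ∈ compactlySupported a b)
    (hab : a < b) {g : ℝ → ℂ} (hg : LocAC g a b) (hfg : f =ᵐ[volume.restrict (Ioo a b)] g) :
    ∃ c d, a < c ∧ c ≤ d ∧ d < b ∧ ∀ x ∈ Ioo a b, x ∉ Icc c d → g x = 0 := by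
  obtain ⟨K, hK, hKs, hK0⟩ := hf
  obtain ⟨c, d, hc, hcd, hd, hKcd⟩ := hK.exists_subset_Icc_of_subset_Ioo hKs hab
  refine ⟨c, d, hc, hcd, hd, ?_⟩
  have hU : IsOpen (Ioo a b ∩ (Icc c d)ᶜ) := isOpen_Ioo.inter isClosed_Icc.isOpen_compl
  have hae : g =ᵐ[volume.restrict (Ioo a b ∩ (Icc c d)ᶜ)] fun _ => 0 := by
    filter_upwards [ae_mono (Measure.restrict_mono inter_subset_left le_rfl) hK0,
      ae_mono (Measure.restrict_mono inter_subset_left le_rfl) hfg,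
      ae_restrict_mem hU.measurableSet] with x h1 h2 h3
    rw [← h2, h1 fun h => h3.2 (hKcd h)]
  have := Measure.eqOn_open_of_ae_eq hae hU (hg.continuousOn.mono inter_subset_left)
    continuousOn_const
  exact fun x hx hxs => this ⟨hx, hxs⟩

end FirstOrderBessel

namespace FirstOrderBessel

/-! ### Hölder estimates and boundary behaviour -/

theorem norm_integral_mul_le_sqrt {α : Type*} [MeasurableSpace α] {μ : Measure α} {k G : α → ℂ}
    (hk : MemLp k 2 μ) (hG : MemLp G 2 μ) :
    ‖∫ x, k x * G x ∂μ‖ ≤ √(∫ x, ‖k x‖ ^ 2 ∂μ) * √(∫ x, ‖G x‖ ^ 2 ∂μ) := by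
  refine (norm_integral_le_integral_norm _).trans ?_
  have h2 : ENNReal.ofReal 2 = 2 := by simp
  have := integral_mul_norm_le_Lp_mul_Lq (p := 2) (q := 2) (f := k) (g := G) (μ := μ)
    Real.HolderConjugate.two_two (by rwa [h2]) (by rwa [h2])
  simp only [norm_mul, Real.sqrt_eq_rpow]
  simpa using this

variable {a b : ℝ} {G : ℝ → ℂ}

theorem sq_norm_powC {r x : ℝ} (hx : a < x) : ‖powC a r x‖ ^ 2 = (x - a) ^ (2 * r) := by
  rw [norm_powC hx, ← Real.rpow_natCast, ← Real.rpow_mul (sub_pos.2 hx).le]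
  congr 1
  push_cast
  ring

/-- This threshold separates the cases of the theorem: with `h = s + 1/2`, the weight `(x - a)^(-h)`
is square integrable iff `s < 0`, and the homogeneous solution `(x - a)^h` iff `-1 < s`. -/
theorem memLp_powC_iff (hab : a < b) {r : ℝ} :
    MemLp (powC a r) 2 (volume.restrict (Ioo a b)) ↔ -1 < 2 * r := by
  have hm : AEStronglyMeasurable (powC a r) (volume.restrict (Ioo a b)) :=
    ((continuousOn_powC a r).mono fun x hx => hx.1).aestronglyMeasurable measurableSet_Ioo
  rw [memLp_two_iff_integrable_sq_norm hm,
    ← intervalIntegral.integrableOn_Ioo_rpow_iff (sub_pos.2 hab)]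
  have h1 : Integrable (fun x => ‖powC a r x‖ ^ 2) (volume.restrict (Ioo a b)) ↔
      IntegrableOn (fun x => (x - a) ^ (2 * r)) (Ioo a b) :=
    integrable_congr (by
      filter_upwards [ae_restrict_mem measurableSet_Ioo] with x hx using sq_norm_powC hx.1)
  rw [h1, ← intervalIntegrable_iff_integrableOn_Ioo_of_le hab.le,
    ← intervalIntegrable_iff_integrableOn_Ioo_of_le (sub_pos.2 hab).le]
  simpa using IntervalIntegrable.comp_sub_right_iff (f := fun x : ℝ => x ^ (2 * r)) (a := 0)
    (b := b - a) (c := a)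

theorem norm_intervalIntegral_powC_mul_le {r x y : ℝ} (hxy : x ≤ y) (hx : a ≤ x)
    (hk : MemLp (powC a r) 2 (volume.restrict (Ioo x y)))
    (hG : MemLp G 2 (volume.restrict (Ioo x y))) :
    ‖∫ t in x..y, powC a r t * G t‖ ≤
      √(∫ t in x..y, (t - a) ^ (2 * r)) * √(∫ t in x..y, ‖G t‖ ^ 2) := by
  simp only [intervalIntegral.integral_of_le hxy, integral_Ioc_eq_integral_Ioo]
  refine (norm_integral_mul_le_sqrt hk hG).trans_eq ?_
  congr 2
  exact setIntegral_congr_fun measurableSet_Ioo fun t ht => sq_norm_powC (hx.trans_lt ht.1)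

theorem memLp_mono_Ioo (hG : MemLp G 2 (volume.restrict (Ioo a b))) {x y : ℝ} (hx : a ≤ x)
    (hy : y ≤ b) : MemLp G 2 (volume.restrict (Ioo x y)) :=
  hG.mono_measure (Measure.restrict_mono (Ioo_subset_Ioo hx hy) le_rfl)

theorem memLp_powC_of_lt {r x y : ℝ} (hx : a < x) :
    MemLp (powC a r) 2 (volume.restrict (Ioo x y)) :=
  ContinuousOn.memLp_Ioo ((continuousOn_powC a r).mono fun _ ht => hx.trans_le ht.1)

theorem integral_rpow_sub_left {r x : ℝ} (hr : -1 < r) :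
    ∫ t in a..x, (t - a) ^ r = (x - a) ^ (r + 1) / (r + 1) := by
  rw [intervalIntegral.integral_comp_sub_right (fun t => t ^ r), integral_rpow (Or.inl hr),
    sub_self, Real.zero_rpow (by linarith), sub_zero]

theorem integral_rpow_sub_le {r x y : ℝ} (hr : r < -1) (hx : a < x) (hxy : x ≤ y) :
    ∫ t in x..y, (t - a) ^ r ≤ (x - a) ^ (r + 1) / (-(r + 1)) := by
  have h0 : (0 : ℝ) ∉ uIcc (x - a) (y - a) := by
    rw [uIcc_of_le (by linarith)]
    exact fun h => by linarith [h.1]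
  rw [intervalIntegral.integral_comp_sub_right (fun t => t ^ r), integral_rpow (Or.inr ⟨hr.ne, h0⟩),
    ← neg_div_neg_eq]
  have : 0 ≤ (y - a) ^ (r + 1) := Real.rpow_nonneg (by linarith) _
  gcongr
  · linarith
  · linarith

theorem integral_rpow_neg_one_sub {x y : ℝ} (hx : a < x) (hxy : x ≤ y) :
    ∫ t in x..y, (t - a) ^ (-1 : ℝ) = Real.log ((y - a) / (x - a)) := by
  rw [intervalIntegral.integral_comp_sub_right (fun t => t ^ (-1 : ℝ))]
  simp only [Real.rpow_neg_one]
  exact integral_inv_of_pos (by linarith) (by linarith)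

/-- The prefactor squared times the integrated weight is `(x - a)^(2h) (x - a)^(1 - 2h) = x - a`;
hence the square root in every boundary condition, whatever `h` is. -/
theorem rpow_mul_sqrt {h x K : ℝ} (hx : a < x) :
    (x - a) ^ h * √((x - a) ^ (2 * -h + 1) * K) = √((x - a) * K) := by
  have hx' := sub_pos.2 hx
  rw [← Real.sqrt_sq (Real.rpow_nonneg hx'.le h), ← Real.sqrt_mul (sq_nonneg _), ← mul_assoc]
  congr 2
  rw [← Real.rpow_natCast, ← Real.rpow_mul hx'.le, ← Real.rpow_add hx']
  push_cast
  ring_nf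
  exact Real.rpow_one _

theorem rpow_mul_sqrt_integral_left {h x : ℝ} (hh : h < 1 / 2) (hx : a < x) :
    (x - a) ^ h * √(∫ t in a..x, (t - a) ^ (2 * -h)) = √((x - a) * (1 - 2 * h)⁻¹) := by
  rw [integral_rpow_sub_left (by linarith), div_eq_mul_inv, rpow_mul_sqrt hx]
  ring_nf

theorem rpow_mul_sqrt_integral_right_le {h x y : ℝ} (hh : 1 / 2 < h) (hx : a < x) (hxy : x ≤ y) :
    (x - a) ^ h * √(∫ t in x..y, (t - a) ^ (2 * -h)) ≤ √((x - a) * (2 * h - 1)⁻¹) := by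
  rw [show 2 * h - 1 = -(2 * -h + 1) by ring, ← rpow_mul_sqrt (h := h) hx, ← div_eq_mul_inv]
  gcongr
  exact integral_rpow_sub_le (by linarith) hx hxy

theorem rpow_mul_sqrt_integral_right_half {x y : ℝ} (hx : a < x) (hxy : x ≤ y) :
    (x - a) ^ (1 / 2 : ℝ) * √(∫ t in x..y, (t - a) ^ (2 * -(1 / 2) : ℝ)) =
      √((x - a) * Real.log ((y - a) / (x - a))) := by
  rw [show (2 * -(1 / 2) : ℝ) = -1 by norm_num, integral_rpow_neg_one_sub hx hxy,
    ← rpow_mul_sqrt (h := 1 / 2) hx, show (2 * -(1 / 2) + 1 : ℝ) = 0 by norm_num, Real.rpow_zero,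
    one_mul]

theorem norm_powC_mul_integral_left_le {h x : ℝ} (hh : h < 1 / 2) (hx : x ∈ Ioc a b)
    (hG : MemLp G 2 (volume.restrict (Ioo a b))) :
    ‖powC a h x * ∫ t in a..x, powC a (-h) t * G t‖ ≤
      √((x - a) * (1 - 2 * h)⁻¹) * √(∫ t in a..x, ‖G t‖ ^ 2) := by
  rw [← rpow_mul_sqrt_integral_left hh hx.1, norm_mul, norm_powC hx.1, mul_assoc]
  gcongr
  · exact Real.rpow_nonneg (sub_pos.2 hx.1).le _
  · exact norm_intervalIntegral_powC_mul_le hx.1.le le_rfl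
      ((memLp_powC_iff hx.1).2 (by linarith)) (memLp_mono_Ioo hG le_rfl hx.2)

theorem norm_powC_mul_integral_right_le {h x y : ℝ} (hx : x ∈ Ioc a b) (hy : y ∈ Ioc a b)
    (hxy : x ≤ y) (hG : MemLp G 2 (volume.restrict (Ioo a b))) :
    ‖powC a h x * ∫ t in x..y, powC a (-h) t * G t‖ ≤
      ((x - a) ^ h * √(∫ t in x..y, (t - a) ^ (2 * -h))) * √(∫ t in x..y, ‖G t‖ ^ 2) := by
  rw [norm_mul, norm_powC hx.1, mul_assoc]
  gcongr
  · exact Real.rpow_nonneg (sub_pos.2 hx.1).le _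
  · exact norm_intervalIntegral_powC_mul_le hxy hx.1.le (memLp_powC_of_lt hx.1)
      (memLp_mono_Ioo hG hx.1.le hy.2)

theorem intervalIntegrable_sq_norm (hG : MemLp G 2 (volume.restrict (Ioo a b))) (hab : a ≤ b) :
    IntervalIntegrable (fun t => ‖G t‖ ^ 2) volume a b := by
  rw [intervalIntegrable_iff_integrableOn_Ioo_of_le hab]
  exact (memLp_two_iff_integrable_sq_norm hG.1).1 hG

theorem integral_sq_norm_mono (hG : MemLp G 2 (volume.restrict (Ioo a b))) {x y x' y' : ℝ}
    (hx : a ≤ x') (hxx : x' ≤ x) (hxy : x ≤ y) (hyy : y ≤ y') (hy : y' ≤ b) :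
    ∫ t in x..y, ‖G t‖ ^ 2 ≤ ∫ t in x'..y', ‖G t‖ ^ 2 :=
  intervalIntegral.integral_mono_interval hxx hxy hyy
    (Eventually.of_forall fun t => by positivity)
    (intervalIntegrable_sq_norm (memLp_mono_Ioo hG hx hy) (by linarith))

theorem tendsto_integral_sq_norm_left (hG : MemLp G 2 (volume.restrict (Ioo a b))) (hab : a < b) :
    Tendsto (fun x => √(∫ t in a..x, ‖G t‖ ^ 2)) (𝓝[>] a) (𝓝 0) := by
  have h := intervalIntegral.continuousOn_primitive_interval'
    (intervalIntegrable_sq_norm hG hab.le) left_mem_uIcc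
  rw [uIcc_of_le hab.le] at h
  have h2 := ((h a (left_mem_Icc.2 hab.le)).mono Ioo_subset_Icc_self).tendsto
  rw [nhdsWithin_Ioo_eq_nhdsGT hab, intervalIntegral.integral_same] at h2
  simpa using h2.sqrt

theorem tendsto_integral_right {f : ℝ → ℂ} {m : ℝ} (hf : IntervalIntegrable f volume m b)
    (hm : m < b) :
    Tendsto (fun x => ∫ t in m..x, f t) (𝓝[<] b) (𝓝 (∫ t in m..b, f t)) := by
  have h := intervalIntegral.continuousOn_primitive_interval' hf left_mem_uIcc
  rw [uIcc_of_le hm.le] at h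
  have h2 := ((h b (right_mem_Icc.2 hm.le)).mono Ioo_subset_Icc_self).tendsto
  rwa [nhdsWithin_Ioo_eq_nhdsLT hm] at h2

theorem tendsto_integral_sq_norm_right (hG : MemLp G 2 (volume.restrict (Ioo a b))) (hab : a < b) :
    Tendsto (fun x => √(∫ t in x..b, ‖G t‖ ^ 2)) (𝓝[<] b) (𝓝 0) := by
  have h := intervalIntegral.continuousOn_primitive_interval'
    (intervalIntegrable_sq_norm hG hab.le) right_mem_uIcc
  rw [uIcc_of_le hab.le] at h
  have h2 := ((h b (right_mem_Icc.2 hab.le)).mono Ioo_subset_Icc_self).tendsto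
  rw [nhdsWithin_Ioo_eq_nhdsLT hab, intervalIntegral.integral_same] at h2
  have h3 := h2.neg.sqrt
  simpa [← intervalIntegral.integral_symm] using h3

section
variable {s : ℝ} {g : ℝ → ℂ} (hg : LocAC g a b) (hG : MemLp G 2 (volume.restrict (Ioo a b)))
  (hgG : G =ᵐ[volume.restrict (Ioo a b)] alpha s a g)
include hg hG hgG

theorem eq_neg_integral_right (hgb : VanishesRight b g) {x : ℝ} (hx : x ∈ Ioo a b) :
    g x = -(powC a (s + 1 / 2) x * ∫ t in x..b, powC a (-(s + 1 / 2)) t * G t) := by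
  have hb : b ∈ Ioc a b := ⟨hx.1.trans hx.2, le_rfl⟩
  have h1 := tendsto_integral_right (intervalIntegrable_powC_mul hG (-(s + 1 / 2))
    (Ioo_subset_Ioc_self hx) hb) hx.2
  have hc : Tendsto (powC a (-(s + 1 / 2))) (𝓝[<] b) (𝓝 (powC a (-(s + 1 / 2)) b)) :=
    ((continuousOn_powC a _).continuousAt (Ioi_mem_nhds hb.1)).tendsto.mono_left nhdsWithin_le_nhds
  have h2 := (hc.mul hgb).sub_const (powC a (-(s + 1 / 2)) x * g x)
  have h3 := tendsto_nhds_unique h1 (h2.congr' (by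
    filter_upwards [Ioo_mem_nhdsLT hb.1] with y hy
    exact powC_mul_sub_eq_integral hg hG hgG hx hy))
  rw [h3, mul_zero, zero_sub, mul_neg, neg_neg, ← mul_assoc, powC_mul_neg hx.1, one_mul]

/-- On `[m, b]` with `m > a` both powers of `x - a` are bounded. Cauchy–Schwarz on the integral from
`x` to `b` then gives `√(b - x)` times the `L²` norm of `G` over `(x, b)`, and this norm tends to
zero. -/
theorem SqrtVanishesRight.of_vanishesRight (hab : a < b) (hgb : VanishesRight b g) :
    SqrtVanishesRight b g := by
  obtain ⟨m, hm⟩ := exists_between hab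
  obtain ⟨C, hC⟩ := isCompact_Icc.exists_bound_of_continuousOn
    ((continuousOn_powC a (s + 1 / 2)).mono (t := Icc m b) fun t ht => hm.1.trans_le ht.1)
  obtain ⟨K, hK⟩ := isCompact_Icc.exists_bound_of_continuousOn
    ((continuousOn_powC a (-(s + 1 / 2))).mono (t := Icc m b) fun t ht => hm.1.trans_le ht.1)
  have hC0 : 0 ≤ C := (norm_nonneg _).trans (hC b ⟨hm.2.le, le_rfl⟩)
  have hK0 : 0 ≤ K := (norm_nonneg _).trans (hK b ⟨hm.2.le, le_rfl⟩)
  have h0 := (tendsto_integral_sq_norm_right hG hab).const_mul (C * K)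
  rw [mul_zero] at h0
  refine squeeze_zero_norm' ?_ h0
  filter_upwards [Ioo_mem_nhdsLT hm.2] with x hx
  have hax : a < x := hm.1.trans hx.1
  have hbx : 0 < b - x := sub_pos.2 hx.2
  rw [norm_div, Complex.norm_real, Real.norm_of_nonneg (Real.sqrt_nonneg _),
    div_le_iff₀ (Real.sqrt_pos.2 hbx), eq_neg_integral_right hg hG hgG hgb ⟨hax, hx.2⟩,
    norm_neg, norm_mul]
  have h1 := norm_intervalIntegral_powC_mul_le (r := -(s + 1 / 2)) hx.2.le hax.le
    (memLp_powC_of_lt hax) (memLp_mono_Ioo hG hax.le le_rfl)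
  have h2 : √(∫ t in x..b, (t - a) ^ (2 * -(s + 1 / 2))) ≤ K * √(b - x) := by
    rw [← Real.sqrt_sq hK0, ← Real.sqrt_mul (sq_nonneg _)]
    refine Real.sqrt_le_sqrt ?_
    have : ‖∫ t in x..b, (t - a) ^ (2 * -(s + 1 / 2))‖ ≤ K ^ 2 * |b - x| := by
      refine intervalIntegral.norm_integral_le_of_norm_le_const fun t ht => ?_
      rw [uIoc_of_le hx.2.le] at ht
      have hat : a < t := hax.trans ht.1
      rw [← sq_norm_powC hat, norm_pow, norm_norm]
      gcongr
      exact hK t ⟨hx.1.le.trans ht.1.le, ht.2⟩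
    rw [abs_of_pos hbx] at this
    exact (Real.le_norm_self _).trans this
  calc ‖powC a (s + 1 / 2) x‖ * ‖∫ t in x..b, powC a (-(s + 1 / 2)) t * G t‖
      ≤ C * ((K * √(b - x)) * √(∫ t in x..b, ‖G t‖ ^ 2)) := by
        gcongr
        · exact hC x ⟨hx.1.le, hx.2.le⟩
        · exact h1.trans (by gcongr)
    _ = _ := by ring

/-- Decay at the left end point relative to a gauge `D` that dominates both `(x - a) ^ (s + 1/2)`
and the Hölder bound for the integral term. -/
theorem tendsto_div_left (hab : a < b) {D : ℝ → ℝ} {K : ℝ} (hD : ∀ᶠ x in 𝓝[>] a, 0 < D x)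
    (hD0 : Tendsto (fun x => (x - a) ^ (s + 1 / 2) / D x) (𝓝[>] a) (𝓝 0))
    (hK : ∀ᶠ y in 𝓝[>] a, ∀ x ∈ Ioo a y,
      (x - a) ^ (s + 1 / 2) * √(∫ t in x..y, (t - a) ^ (2 * -(s + 1 / 2))) ≤ K * D x) :
    Tendsto (fun x => g x / (D x : ℂ)) (𝓝[>] a) (𝓝 0) := by
  rw [Metric.tendsto_nhds]
  intro ε hε
  have h0 := (tendsto_integral_sq_norm_left hG hab).const_mul K
  rw [mul_zero] at h0
  -- First fix `y` so close to `a` that the tail of `G` on `(a, y)` contributes less than `ε / 2`;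
  -- only then let `x` tend to `a`, which makes the term frozen at `y` less than `ε / 2`.
  obtain ⟨y, hKy, hy, hyε⟩ := (hK.and ((eventually_mem_set.2 (Ioo_mem_nhdsGT hab)).and
    (h0.eventually_lt_const (half_pos hε)))).exists
  have h1 := hD0.const_mul ‖powC a (-(s + 1 / 2)) y * g y‖
  rw [mul_zero] at h1
  filter_upwards [hD, h1.eventually_lt_const (half_pos hε), Ioo_mem_nhdsGT hy.1] with x hDx hx1 hx
  have hxb : x ∈ Ioo a b := ⟨hx.1, hx.2.trans hy.2⟩
  rw [dist_zero_right, norm_div, Complex.norm_real, Real.norm_of_nonneg hDx.le]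
  have h2 := norm_powC_mul_integral_right_le (h := s + 1 / 2) (Ioo_subset_Ioc_self hxb)
    (Ioo_subset_Ioc_self hy) hx.2.le hG
  have h3 : g x = powC a (s + 1 / 2) x * (powC a (-(s + 1 / 2)) y * g y) -
      powC a (s + 1 / 2) x * ∫ t in x..y, powC a (-(s + 1 / 2)) t * G t := by
    rw [← powC_mul_sub_eq_integral hg hG hgG hxb hy, ← mul_sub, sub_sub_cancel, ← mul_assoc,
      powC_mul_neg hx.1, one_mul]
  have h4 : ‖g x‖ ≤ ‖powC a (-(s + 1 / 2)) y * g y‖ * (x - a) ^ (s + 1 / 2) +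
      (K * D x) * √(∫ t in a..y, ‖G t‖ ^ 2) := by
    rw [h3]
    refine (norm_sub_le _ _).trans (add_le_add ?_ (h2.trans ?_))
    · rw [norm_mul, norm_powC hx.1, mul_comm]
    · exact mul_le_mul (hKy x hx)
        (Real.sqrt_le_sqrt (integral_sq_norm_mono hG le_rfl hx.1.le hx.2.le le_rfl hy.2.le))
        (Real.sqrt_nonneg _) ((mul_nonneg (Real.rpow_nonneg (sub_pos.2 hx.1).le _)
          (Real.sqrt_nonneg _)).trans (hKy x hx))
  calc ‖g x‖ / D x ≤ (‖powC a (-(s + 1 / 2)) y * g y‖ * (x - a) ^ (s + 1 / 2) +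
      (K * D x) * √(∫ t in a..y, ‖G t‖ ^ 2)) / D x := by gcongr
    _ = ‖powC a (-(s + 1 / 2)) y * g y‖ * ((x - a) ^ (s + 1 / 2) / D x) +
      K * √(∫ t in a..y, ‖G t‖ ^ 2) := by field_simp
    _ < ε := by linarith

end

end FirstOrderBessel

namespace FirstOrderBessel

/-! ### Boundary conditions and a priori bounds -/

variable {a b : ℝ} {G : ℝ → ℂ}

theorem tendsto_sub_nhdsGT_zero (a : ℝ) : Tendsto (fun x => x - a) (𝓝[>] a) (𝓝[>] 0) := by
  refine tendsto_nhdsWithin_iff.2 ⟨?_, ?_⟩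
  · have : ContinuousAt (fun x : ℝ => x - a) a := by fun_prop
    simpa using this.tendsto.mono_left nhdsWithin_le_nhds
  · filter_upwards [self_mem_nhdsWithin] with x hx using (sub_pos.2 hx : (0 : ℝ) < x - a)

theorem tendsto_sqrt_mul_log_left {R : ℝ} (hR : 0 < R) (a : ℝ) :
    Tendsto (fun x => √((x - a) * Real.log (R / (x - a)))) (𝓝[>] a) (𝓝 0) := by
  have h1 : Tendsto (fun y : ℝ => Real.log R * y - Real.log y * y ^ (1 : ℝ)) (𝓝[>] 0) (𝓝 0) := by
    have h2 : Tendsto (fun y : ℝ => Real.log R * y) (𝓝[>] 0) (𝓝 (Real.log R * 0)) :=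
      (tendsto_id.const_mul _).mono_left nhdsWithin_le_nhds
    simpa using h2.sub (tendsto_log_mul_rpow_nhdsGT_zero one_pos)
  have h3 := (h1.comp (tendsto_sub_nhdsGT_zero a)).sqrt
  rw [Real.sqrt_zero] at h3
  refine h3.congr' ?_
  filter_upwards [self_mem_nhdsWithin] with x hx
  have hx' : 0 < x - a := sub_pos.2 hx
  simp only [Function.comp_apply, Real.rpow_one]
  rw [Real.log_div hR.ne' hx'.ne']
  ring_nf

theorem eventually_log_pos {R : ℝ} (hR : 0 < R) (a : ℝ) :
    ∀ᶠ x in 𝓝[>] a, 0 < Real.log (R / (x - a)) := by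
  filter_upwards [Ioo_mem_nhdsGT (show a < a + R by linarith)] with x hx
  refine Real.log_pos ?_
  rw [one_lt_div (sub_pos.2 hx.1)]
  linarith [hx.2]

theorem tendsto_of_tendsto_div {l : Filter ℝ} {g : ℝ → ℂ} {D : ℝ → ℝ} (hD : ∀ᶠ x in l, D x ≠ 0)
    (hD0 : Tendsto D l (𝓝 0)) (h : Tendsto (fun x => g x / (D x : ℂ)) l (𝓝 0)) :
    Tendsto g l (𝓝 0) := by
  have h1 : Tendsto (fun x => (D x : ℂ)) l (𝓝 0) :=
    (Complex.continuous_ofReal.tendsto' 0 0 Complex.ofReal_zero).comp hD0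
  have h2 := h.mul h1
  rw [zero_mul] at h2
  refine h2.congr' ?_
  filter_upwards [hD] with x hx
  exact div_mul_cancel₀ _ (Complex.ofReal_ne_zero.2 hx)

theorem SqrtVanishesLeft.vanishesLeft {g : ℝ → ℂ} (h : SqrtVanishesLeft a g) :
    VanishesLeft a g := by
  refine tendsto_of_tendsto_div ?_ ?_ h
  · filter_upwards [self_mem_nhdsWithin] with x hx using (Real.sqrt_pos.2 (sub_pos.2 hx)).ne'
  · simpa using ((tendsto_sub_nhdsGT_zero a).mono_right nhdsWithin_le_nhds).sqrt

theorem LogSqrtVanishesLeft.vanishesLeft {R : ℝ} (hR : 0 < R) {g : ℝ → ℂ}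
    (h : LogSqrtVanishesLeft R a g) : VanishesLeft a g := by
  refine tendsto_of_tendsto_div ?_ (tendsto_sqrt_mul_log_left hR a) h
  filter_upwards [self_mem_nhdsWithin, eventually_log_pos hR a] with x hx hl
  exact (Real.sqrt_pos.2 (mul_pos (sub_pos.2 hx) hl)).ne'

theorem SqrtVanishesRight.vanishesRight {g : ℝ → ℂ} (h : SqrtVanishesRight b g) :
    VanishesRight b g := by
  refine tendsto_of_tendsto_div ?_ ?_ h
  · filter_upwards [self_mem_nhdsWithin] with x hx using (Real.sqrt_pos.2 (sub_pos.2 hx)).ne'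
  · have : ContinuousAt (fun x : ℝ => √(b - x)) b := by fun_prop
    simpa using this.tendsto.mono_left nhdsWithin_le_nhds

section
variable {s : ℝ} {g : ℝ → ℂ} (hg : LocAC g a b) (hG : MemLp G 2 (volume.restrict (Ioo a b)))
  (hgG : G =ᵐ[volume.restrict (Ioo a b)] alpha s a g)
include hg hG hgG

theorem sqrtVanishesLeft_of_pos (hab : a < b) (hs : 0 < s) : SqrtVanishesLeft a g := by
  refine tendsto_div_left hg hG hgG hab (K := √(2 * (s + 1 / 2) - 1)⁻¹) ?_ ?_ ?_
  · filter_upwards [self_mem_nhdsWithin] with x hx using Real.sqrt_pos.2 (sub_pos.2 hx)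
  · have h1 : Tendsto (fun y : ℝ => y ^ s) (𝓝[>] 0) (𝓝 0) := by
      have := (Real.continuousAt_rpow_const 0 s (Or.inr hs.le)).tendsto
      rw [Real.zero_rpow hs.ne'] at this
      exact this.mono_left nhdsWithin_le_nhds
    refine (h1.comp (tendsto_sub_nhdsGT_zero a)).congr' ?_
    filter_upwards [self_mem_nhdsWithin] with x hx
    rw [Function.comp_apply, Real.sqrt_eq_rpow, ← Real.rpow_sub (sub_pos.2 hx),
      add_sub_cancel_right]
  · refine Eventually.of_forall fun y x hx => ?_
    refine (rpow_mul_sqrt_integral_right_le (by linarith) hx.1 hx.2.le).trans_eq ?_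
    rw [Real.sqrt_mul (sub_pos.2 hx.1).le, mul_comm]

/-- For `s < 0` the weight is square integrable up to `a`, so the base point of the integral can be
moved to the singular end. -/
theorem eq_mul_const_add_integral_left (hs : s < 0) (hab : a < b) :
    ∃ c : ℂ, ∀ x ∈ Ioo a b, g x =
      powC a (s + 1 / 2) x * (c + ∫ t in a..x, powC a (-(s + 1 / 2)) t * G t) := by
  obtain ⟨m, hm⟩ := exists_between hab
  have hk : MemLp (powC a (-(s + 1 / 2))) 2 (volume.restrict (Ioo a b)) :=
    (memLp_powC_iff hab).2 (by linarith)
  have hI : ∀ x ∈ Ioo a b, IntervalIntegrable (fun t => powC a (-(s + 1 / 2)) t * G t)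
      volume a x := fun x hx => by
    rw [intervalIntegrable_iff_integrableOn_Ioo_of_le hx.1.le]
    exact IntegrableOn.mono_set (hk.integrable_mul hG) (Ioo_subset_Ioo le_rfl hx.2.le)
  refine ⟨powC a (-(s + 1 / 2)) m * g m - ∫ t in a..m, powC a (-(s + 1 / 2)) t * G t,
    fun x hx => ?_⟩
  rw [← intervalIntegral.integral_add_adjacent_intervals (hI m hm) ((hI m hm).symm.trans (hI x hx)),
    ← powC_mul_sub_eq_integral hg hG hgG hm hx, ← add_assoc, sub_add_cancel, add_sub_cancel,
    ← mul_assoc, powC_mul_neg hx.1, one_mul]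

/-- The integral part of `g` is bounded, hence in `L²`. If `c ≠ 0`, then `(x - a)^h` would be in
`L²` as well, contradicting `2h ≤ -1`. With `c = 0` only the integral part remains, and it has the
required decay. -/
theorem sqrtVanishesLeft_of_le_neg_one (hab : a < b)
    (hg2 : MemLp g 2 (volume.restrict (Ioo a b))) (hs : s ≤ -1) : SqrtVanishesLeft a g := by
  obtain ⟨c, hc⟩ := eq_mul_const_add_integral_left hg hG hgG (by linarith) hab
  set h := s + 1 / 2 with hh
  have hbd := fun x (hx : x ∈ Ioo a b) =>
    norm_powC_mul_integral_left_le (h := h) (by linarith) (Ioo_subset_Ioc_self hx) hG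
  have hc0 : c = 0 := by
    by_contra hc0
    have hcont : ContinuousOn (powC a h) (Ioo a b) :=
      (continuousOn_powC a h).mono fun x hx => hx.1
    have h1 : MemLp (fun x => g x - powC a h x * c) 2 (volume.restrict (Ioo a b)) := by
      refine MemLp.of_bound ((hg.continuousOn.sub (hcont.mul
        continuousOn_const)).aestronglyMeasurable measurableSet_Ioo)
        (√((b - a) * (1 - 2 * h)⁻¹) * √(∫ t in a..b, ‖G t‖ ^ 2)) ?_
      filter_upwards [ae_restrict_mem measurableSet_Ioo] with x hx
      rw [hc x hx, mul_add, add_sub_cancel_left]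
      refine (hbd x hx).trans ?_
      have : 0 ≤ (1 - 2 * h)⁻¹ := inv_nonneg.2 (by linarith)
      have h2 := integral_sq_norm_mono hG le_rfl le_rfl hx.1.le hx.2.le le_rfl
      have h3 := hx.2.le
      gcongr
    have h2 := (hg2.sub h1).const_mul c⁻¹
    have h3 : MemLp (powC a h) 2 (volume.restrict (Ioo a b)) := by
      refine h2.ae_eq (Eventually.of_forall fun x => ?_)
      simp only [Pi.sub_apply]
      rw [sub_sub_cancel, mul_comm, mul_assoc, mul_inv_cancel₀ hc0, mul_one]
    have := (memLp_powC_iff hab).1 h3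
    linarith
  have h0 := (tendsto_integral_sq_norm_left hG hab).const_mul (√(1 - 2 * h)⁻¹)
  rw [mul_zero] at h0
  refine squeeze_zero_norm' ?_ h0
  filter_upwards [Ioo_mem_nhdsGT hab] with x hx
  have hx0 : 0 < x - a := sub_pos.2 hx.1
  rw [norm_div, Complex.norm_real, Real.norm_of_nonneg (Real.sqrt_nonneg _),
    div_le_iff₀ (Real.sqrt_pos.2 hx0), hc x hx, hc0, zero_add]
  refine (hbd x hx).trans_eq ?_
  rw [Real.sqrt_mul hx0.le]
  ring

omit hgG in
-- At `s = 0` the weight integrates to `log((y - a)/(x - a))`, which is at most `log(R/(x - a))`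
-- once `y < a + R`. The homogeneous solution `(x - a)^(1/2)` is itself smaller than the gauge by a
-- factor `log(R/(x - a))^(-1/2)`, so no condition on `g` is needed.
theorem logSqrtVanishesLeft (hgG : G =ᵐ[volume.restrict (Ioo a b)] alpha 0 a g) (hab : a < b)
    {R : ℝ} (hR : 0 < R) : LogSqrtVanishesLeft R a g := by
  have hpos : ∀ᶠ x in 𝓝[>] a, 0 < √((x - a) * Real.log (R / (x - a))) := by
    filter_upwards [self_mem_nhdsWithin, eventually_log_pos hR a] with x hx hl
      using Real.sqrt_pos.2 (mul_pos (sub_pos.2 hx) hl)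
  refine tendsto_div_left hg hG hgG hab (K := 1) hpos ?_ ?_
  · have h1 : Tendsto (fun y : ℝ => Real.log (R / y)) (𝓝[>] 0) atTop := by
      refine Real.tendsto_log_atTop.comp ?_
      exact (tendsto_inv_nhdsGT_zero.const_mul_atTop hR)
    have h2 := ((Real.tendsto_sqrt_atTop.comp h1).comp
      (tendsto_sub_nhdsGT_zero a)).inv_tendsto_atTop
    refine h2.congr' ?_
    filter_upwards [self_mem_nhdsWithin] with x hx
    have hx0 : 0 < x - a := sub_pos.2 hx
    simp only [Pi.inv_apply, Function.comp_apply]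
    rw [Real.sqrt_mul hx0.le, zero_add, ← Real.sqrt_eq_rpow,
      div_mul_cancel_left₀ (Real.sqrt_pos.2 hx0).ne']
  · filter_upwards [Ioo_mem_nhdsGT (show a < a + R by linarith)] with y hy x hx
    rw [zero_add, rpow_mul_sqrt_integral_right_half hx.1 hx.2.le, one_mul]
    have hx0 : 0 < x - a := sub_pos.2 hx.1
    have hy0 : 0 < y - a := sub_pos.2 hy.1
    have : y - a ≤ R := by linarith [hy.2]
    gcongr

end

theorem norm_eq_sqrt_integral (hab : a ≤ b) (F : L2Ioo a b) :
    ‖F‖ = √(∫ t in a..b, ‖F t‖ ^ 2) := by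
  rw [intervalIntegral.integral_of_le hab, integral_Ioc_eq_integral_Ioo,
    norm_eq_sqrt_re_inner (𝕜 := ℂ) F, L2.inner_def, ← integral_re (L2.integrable_inner F F)]
  congr 2
  ext t
  rw [inner_self_eq_norm_sq (𝕜 := ℂ)]

theorem norm_le_of_ae_le_mul (hab : a ≤ b) {f : L2Ioo a b} {g : ℝ → ℂ} {C : ℝ} (hC : 0 ≤ C)
    (hfg : f =ᵐ[volume.restrict (Ioo a b)] g) (h : ∀ x ∈ Ioo a b, ‖g x‖ ≤ C) :
    ‖f‖ ≤ √(b - a) * C := by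
  have h1 := Lp.norm_le_of_ae_bound (f := f) hC (by
    filter_upwards [hfg, ae_restrict_mem measurableSet_Ioo] with x hx hm
    rw [hx]
    exact h x hm)
  refine h1.trans_eq ?_
  congr 1
  rw [Real.sqrt_eq_rpow]
  simp only [measureUnivNNReal, Measure.restrict_apply_univ, Real.volume_Ioo, one_div,
    ENNReal.toReal_ofNat]
  exact congrArg (· ^ (2⁻¹ : ℝ)) (ENNReal.toReal_ofReal (sub_nonneg.2 hab))

/-- An a priori bound for functions vanishing at the right end point. -/
theorem norm_le_of_vanishesRight (hab : a < b) {s : ℝ} (hs : 0 ≤ s) :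
    ∃ K, ∀ (f F : L2Ioo a b) (g : ℝ → ℂ), LocAC g a b → f =ᵐ[volume.restrict (Ioo a b)] g →
      F =ᵐ[volume.restrict (Ioo a b)] alpha s a g → VanishesRight b g → ‖f‖ ≤ K * ‖F‖ := by
  obtain ⟨M, hM⟩ : ∃ M, ∀ x ∈ Ioo a b,
      (x - a) ^ (s + 1 / 2) * √(∫ t in x..b, (t - a) ^ (2 * -(s + 1 / 2))) ≤ √M := by
    rcases hs.eq_or_lt with rfl | hs
    · refine ⟨b - a, fun x hx => ?_⟩
      rw [zero_add, rpow_mul_sqrt_integral_right_half hx.1 hx.2.le]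
      have hx0 : 0 < x - a := sub_pos.2 hx.1
      refine Real.sqrt_le_sqrt ?_
      -- `log t ≤ t - 1` at `t = (b - a)/(x - a)` bounds `(x - a) log t` uniformly by `b - a`.
      have h1 := Real.log_le_sub_one_of_pos (div_pos (sub_pos.2 hab) hx0)
      calc (x - a) * Real.log ((b - a) / (x - a)) ≤ (x - a) * ((b - a) / (x - a) - 1) := by gcongr
        _ = (b - a) - (x - a) := by field_simp
        _ ≤ b - a := by linarith
    · refine ⟨(b - a) * (2 * (s + 1 / 2) - 1)⁻¹, fun x hx => ?_⟩
      refine (rpow_mul_sqrt_integral_right_le (by linarith) hx.1 hx.2.le).trans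
        (Real.sqrt_le_sqrt ?_)
      have h1 : 0 ≤ (2 * (s + 1 / 2) - 1)⁻¹ := inv_nonneg.2 (by linarith)
      have h2 := hx.2.le
      gcongr
  refine ⟨√(b - a) * √M, fun f F g hg hf hF hgb => ?_⟩
  rw [mul_assoc]
  refine norm_le_of_ae_le_mul hab.le (by positivity) hf fun x hx => ?_
  rw [eq_neg_integral_right hg (Lp.memLp F) hF hgb hx, norm_neg]
  refine (norm_powC_mul_integral_right_le (Ioo_subset_Ioc_self hx) ⟨hab, le_rfl⟩ hx.2.le
    (Lp.memLp F)).trans ?_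
  refine mul_le_mul (hM x hx) ?_ (Real.sqrt_nonneg _) (Real.sqrt_nonneg _)
  rw [norm_eq_sqrt_integral hab.le]
  exact Real.sqrt_le_sqrt
    (integral_sq_norm_mono (Lp.memLp F) le_rfl hx.1.le hx.2.le le_rfl le_rfl)

/-- Near `a` the bracket `c + ∫_a^x` vanishes together with `g`, while it tends to `c`; hence `c =
0`. -/
theorem eq_integral_left {s : ℝ} {g : ℝ → ℂ} (hg : LocAC g a b)
    (hG : MemLp G 2 (volume.restrict (Ioo a b)))
    (hgG : G =ᵐ[volume.restrict (Ioo a b)] alpha s a g) (hs : s < 0) (hab : a < b)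
    (h0 : ∀ᶠ x in 𝓝[>] a, g x = 0) {x : ℝ} (hx : x ∈ Ioo a b) :
    g x = powC a (s + 1 / 2) x * ∫ t in a..x, powC a (-(s + 1 / 2)) t * G t := by
  obtain ⟨c, hc⟩ := eq_mul_const_add_integral_left hg hG hgG hs hab
  have hk : MemLp (powC a (-(s + 1 / 2))) 2 (volume.restrict (Ioo a b)) :=
    (memLp_powC_iff hab).2 (by linarith)
  have hI : IntervalIntegrable (fun t => powC a (-(s + 1 / 2)) t * G t) volume a b := by
    rw [intervalIntegrable_iff_integrableOn_Ioo_of_le hab.le]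
    exact hk.integrable_mul hG
  have h1 := intervalIntegral.continuousOn_primitive_interval' hI left_mem_uIcc
  rw [uIcc_of_le hab.le] at h1
  have h2 := ((h1 a (left_mem_Icc.2 hab.le)).mono Ioo_subset_Icc_self).tendsto.const_add c
  rw [nhdsWithin_Ioo_eq_nhdsGT hab, intervalIntegral.integral_same, add_zero] at h2
  have h3 : c = 0 := by
    refine tendsto_nhds_unique h2 (tendsto_const_nhds.congr' ?_)
    filter_upwards [h0, Ioo_mem_nhdsGT hab] with y hy hym
    rw [hc y hym] at hy
    exact ((mul_eq_zero.1 hy).resolve_left (powC_ne_zero hym.1)).symm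
  rw [hc x hx, h3, zero_add]

/-- A compactly supported function vanishes near both ends, so one may integrate from whichever end
gives a bounded kernel: from `b` if `s ≥ 0`, from `a` if `s < 0`. -/
theorem norm_le_of_mem_graph_opPreMin (hab : a < b) (s : ℝ) :
    ∃ K, ∀ p ∈ (opPreMin s a b).graph, ‖p.1‖ ≤ K * ‖p.2‖ := by
  rcases le_or_gt 0 s with hs | hs
  · obtain ⟨K, hK⟩ := norm_le_of_vanishesRight hab hs
    refine ⟨K, fun p hp => ?_⟩
    obtain ⟨⟨g, hg, h1, h2⟩, hc⟩ := mem_graph_opPreMin.1 hp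
    obtain ⟨c, d, hac, hcd, hdb, h0⟩ := eqOn_zero_of_compactlySupported hc hab hg h1
    refine hK p.1 p.2 g hg h1 h2 (tendsto_const_nhds.congr' ?_)
    filter_upwards [Ioo_mem_nhdsLT hdb] with x hx
    exact (h0 x ⟨(hac.trans_le hcd).trans hx.1, hx.2⟩ fun h => hx.1.not_ge h.2).symm
  · refine ⟨√(b - a) * √((b - a) * (1 - 2 * (s + 1 / 2))⁻¹), fun p hp => ?_⟩
    obtain ⟨⟨g, hg, h1, h2⟩, hc⟩ := mem_graph_opPreMin.1 hp
    obtain ⟨c, d, hac, hcd, hdb, h0⟩ := eqOn_zero_of_compactlySupported hc hab hg h1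
    rw [mul_assoc]
    refine norm_le_of_ae_le_mul hab.le (by positivity) h1 fun x hx => ?_
    rw [eq_integral_left hg (Lp.memLp p.2) h2 hs hab (by
      filter_upwards [Ioo_mem_nhdsGT hac] with x hx
      exact h0 x ⟨hx.1, hx.2.trans (hcd.trans_lt hdb)⟩ fun h => hx.2.not_ge h.1) hx]
    refine (norm_powC_mul_integral_left_le (by linarith) (Ioo_subset_Ioc_self hx)
      (Lp.memLp p.2)).trans ?_
    have h3 : 0 ≤ (1 - 2 * (s + 1 / 2))⁻¹ := inv_nonneg.2 (by linarith)
    have h4 := hx.2.le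
    have h5 := integral_sq_norm_mono (Lp.memLp p.2) le_rfl le_rfl hx.1.le hx.2.le le_rfl
    rw [norm_eq_sqrt_integral hab.le]
    gcongr

end FirstOrderBessel

namespace FirstOrderBessel

/-! ### Test functions and the minimal operator -/

open scoped InnerProductSpace

variable {a b : ℝ}

theorem IsTest.mul_left {φ k : ℝ → ℂ} (hφ : IsTest φ a b) (hk : ContDiffOn ℝ ∞ k (Ioi a)) :
    IsTest (fun x => k x * φ x) a b := by
  have hsub : tsupport (fun x => k x * φ x) ⊆ tsupport φ := tsupport_mul_subset_right
  refine ⟨contDiff_iff_contDiffAt.2 fun x => ?_, hφ.2.1.mul_left, hsub.trans hφ.2.2⟩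
  by_cases hx : x ∈ tsupport φ
  · exact (hk.contDiffAt (Ioi_mem_nhds (hφ.2.2 hx).1)).mul hφ.1.contDiffAt
  · refine (contDiffAt_const (c := 0)).congr_of_eventuallyEq ?_
    filter_upwards [notMem_tsupport_iff_eventuallyEq.1 hx] with y hy
    rw [hy, Pi.zero_apply, mul_zero]

theorem IsTest.powC_mul {φ : ℝ → ℂ} (hφ : IsTest φ a b) (r : ℝ) :
    IsTest (fun x => powC a r x * φ x) a b :=
  hφ.mul_left (contDiffOn_powC a r)

theorem IsTest.sub_const_mul {φ ψ : ℝ → ℂ} (hφ : IsTest φ a b) (hψ : IsTest ψ a b) (c : ℂ) :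
    IsTest (fun x => φ x - c * ψ x) a b := by
  have h := hψ.mul_left (k := fun _ => c) contDiffOn_const
  exact ⟨hφ.1.sub h.1, hφ.2.1.sub h.2.1,
    (tsupport_sub φ (fun x => c * ψ x)).trans (union_subset hφ.2.2 h.2.2)⟩

theorem IsTest.ofReal {g : ℝ → ℝ} (hg : ContDiff ℝ ∞ g) (hc : HasCompactSupport g)
    (hs : tsupport g ⊆ Ioo a b) : IsTest (fun x => (g x : ℂ)) a b := by
  have h : tsupport (fun x => (g x : ℂ)) ⊆ tsupport g :=
    closure_mono fun x hx => by simpa using hx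
  exact ⟨Complex.ofRealCLM.contDiff.comp hg, hc.comp_left (g := Complex.ofReal) Complex.ofReal_zero,
    h.trans hs⟩

theorem IsTest.memLp {φ : ℝ → ℂ} (hφ : IsTest φ a b) : MemLp φ 2 (volume.restrict (Ioo a b)) :=
  ContinuousOn.memLp_Ioo hφ.1.continuous.continuousOn

theorem IsTest.eq_zero {φ : ℝ → ℂ} (hφ : IsTest φ a b) {x : ℝ} (hx : x ∉ Ioo a b) : φ x = 0 :=
  image_eq_zero_of_notMem_tsupport fun h => hx (hφ.2.2 h)

/-- Zero mean makes the primitive from `a` vanish again to the right of the support. -/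
theorem IsTest.exists_primitive (hab : a < b) {η : ℝ → ℂ} (hη : IsTest η a b)
    (h0 : ∫ t in a..b, η t = 0) : ∃ Φ, IsTest Φ a b ∧ ∀ x, HasDerivAt Φ (η x) x := by
  obtain ⟨c, d, hc, hcd, hd, hK⟩ := hη.2.1.isCompact.exists_subset_Icc_of_subset_Ioo hη.2.2 hab
  have hη0 : ∀ x, x ∉ Icc c d → η x = 0 := fun x hx =>
    image_eq_zero_of_notMem_tsupport fun h => hx (hK h)
  have hcont := hη.1.continuous
  have hd' : ∀ x, HasDerivAt (fun x => ∫ t in a..x, η t) (η x) x := fun x =>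
    intervalIntegral.integral_hasDerivAt_right (hcont.intervalIntegrable _ _)
      hcont.aestronglyMeasurable.stronglyMeasurableAtFilter hcont.continuousAt
  have hz : ∀ x, x ∉ Icc c d → ∫ t in a..x, η t = 0 := by
    intro x hx
    rw [mem_Icc, not_and_or, not_le, not_le] at hx
    rcases hx with hx | hx
    · rw [intervalIntegral.integral_congr (g := fun _ => 0), intervalIntegral.integral_zero]
      exact fun t ht => hη0 t fun h => (max_lt hc hx).not_ge (h.1.trans ht.2)
    · rw [← intervalIntegral.integral_add_adjacent_intervals (b := b)
        (hcont.intervalIntegrable _ _) (hcont.intervalIntegrable _ _), h0, zero_add,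
        intervalIntegral.integral_congr (g := fun _ => 0), intervalIntegral.integral_zero]
      exact fun t ht => hη0 t fun h => (lt_min hd hx).not_ge (ht.1.trans h.2)
  have hsub : tsupport (fun x => ∫ t in a..x, η t) ⊆ Icc c d :=
    closure_minimal (fun x hx => by_contra fun h => hx (hz x h)) isClosed_Icc
  refine ⟨_, ⟨?_, isCompact_Icc.of_isClosed_subset (isClosed_tsupport _) hsub,
    hsub.trans (Icc_subset_Ioo hc hd)⟩, hd'⟩
  rw [contDiff_infty_iff_deriv]
  exact ⟨fun x => (hd' x).differentiableAt, by simpa only [deriv_eq hd'] using hη.1⟩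

/-- The range of the restriction of `alpha s a` to test functions. -/
noncomputable def testRange (s a b : ℝ) : Submodule ℂ (L2Ioo a b) :=
  (opSmooth s a b).graph.map (LinearMap.snd ℂ (L2Ioo a b) (L2Ioo a b))

/-- The equation `α_s φ = ψ` is solved by `φ = (x - a)^(s + 1/2) Φ`, where `Φ` is the primitive of
`(x - a)^(-(s + 1/2)) ψ`; the moment condition keeps `Φ` compactly supported. -/
theorem toLp_mem_testRange (hab : a < b) (s : ℝ) {ψ : ℝ → ℂ} (hψ : IsTest ψ a b)
    (h0 : ∫ t in Ioo a b, powC a (-(s + 1 / 2)) t * ψ t = 0) :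
    hψ.memLp.toLp ∈ testRange s a b := by
  obtain ⟨Φ, hΦ, hd⟩ := (hψ.powC_mul (-(s + 1 / 2))).exists_primitive hab (by
    rwa [intervalIntegral.integral_of_le hab.le, integral_Ioc_eq_integral_Ioo])
  have hφ := hΦ.powC_mul (s + 1 / 2)
  refine ⟨(hφ.memLp.toLp, hψ.memLp.toLp), mem_graph_opSmooth.2
    ⟨_, hφ, hφ.memLp.coeFn_toLp, hψ.memLp.coeFn_toLp.trans ?_⟩, rfl⟩
  filter_upwards [ae_restrict_mem measurableSet_Ioo] with x hx
  have h1 := (hasDerivAt_powC (r := s + 1 / 2) hx.1).mul (hd x)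
  rw [alpha, show deriv (fun x => powC a (s + 1 / 2) x * Φ x) x = _ from h1.deriv, ← mul_assoc,
    powC_mul_neg hx.1]
  ring

theorem ae_eq_zero_of_integral_test_eq_zero {f : ℝ → ℂ} (hf : LocallyIntegrableOn f (Ioo a b))
    (h : ∀ g, IsTest g a b → ∫ x in Ioo a b, g x * f x = 0) :
    f =ᵐ[volume.restrict (Ioo a b)] 0 := by
  rw [EventuallyEq, ae_restrict_iff' measurableSet_Ioo]
  refine isOpen_Ioo.ae_eq_zero_of_integral_contDiff_smul_eq_zero hf fun g hg hc hs => ?_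
  have hT := IsTest.ofReal hg hc hs
  rw [← h _ hT, setIntegral_eq_integral_of_forall_compl_eq_zero fun x hx => by
    rw [hT.eq_zero hx, zero_mul]]
  simp only [Complex.real_smul]

theorem locallyIntegrableOn_of_memLp {f : ℝ → ℂ} (hf : MemLp f 2 (volume.restrict (Ioo a b))) :
    LocallyIntegrableOn f (Ioo a b) :=
  IntegrableOn.locallyIntegrableOn (hf.integrable (by norm_num))

theorem locallyIntegrableOn_powC (r : ℝ) : LocallyIntegrableOn (powC a r) (Ioo a b) :=
  ((continuousOn_powC a r).mono fun _ hx => hx.1).locallyIntegrableOn measurableSet_Ioo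

theorem exists_integral_powC_mul_ne_zero (hab : a < b) (r : ℝ) :
    ∃ θ, IsTest θ a b ∧ ∫ x in Ioo a b, powC a r x * θ x ≠ 0 := by
  by_contra! h
  have h1 := ae_eq_zero_of_integral_test_eq_zero (locallyIntegrableOn_powC (a := a) (b := b) r)
    fun g hg => by simpa only [mul_comm] using h g hg
  have : NeBot (ae (volume.restrict (Ioo a b))) := by
    rw [ae_neBot, Ne, Measure.restrict_eq_zero]
    simp [hab]
  obtain ⟨x, hx, hxm⟩ := (h1.and (ae_restrict_mem measurableSet_Ioo)).exists
  exact powC_ne_zero hxm.1 hx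

theorem IsTest.integrable_mul {g f : ℝ → ℂ} (hg : IsTest g a b)
    (hf : LocallyIntegrableOn f (Ioo a b)) :
    Integrable (fun x => f x * g x) (volume.restrict (Ioo a b)) := by
  have h1 : IntegrableOn f (tsupport g) := hf.integrableOn_compact_subset hg.2.2 hg.2.1.isCompact
  have h2 : IntegrableOn (fun x => f x * g x) (tsupport g) :=
    h1.mul_continuousOn hg.1.continuous.continuousOn hg.2.1.isCompact
  have h3 : Integrable (fun x => f x * g x) :=
    (integrableOn_iff_integrable_of_support_subset fun x hx =>
      subset_tsupport g (right_ne_zero_of_mul hx)).1 h2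
  exact h3.integrableOn

/-- If `q` is orthogonal to the range, then `star q` annihilates every test function that `w`
annihilates, hence `star q = c w`. Either `c = 0`, or `w` is in `L²` and the moment hypothesis on
`G` gives `q ⊥ G`. -/
theorem mem_closure_testRange (hab : a < b) (s : ℝ) (G : L2Ioo a b)
    (hG : MemLp (powC a (-(s + 1 / 2))) 2 (volume.restrict (Ioo a b)) →
      ∫ t in Ioo a b, powC a (-(s + 1 / 2)) t * G t = 0) :
    G ∈ (testRange s a b).topologicalClosure := by
  rw [← Submodule.orthogonal_orthogonal_eq_closure, Submodule.mem_orthogonal]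
  intro q hq
  set w := powC a (-(s + 1 / 2)) with hw
  have hQ : MemLp (fun x => star (q x)) 2 (volume.restrict (Ioo a b)) := (Lp.memLp q).star
  have hin : ∀ F : L2Ioo a b, ⟪q, F⟫_ℂ = ∫ x in Ioo a b, star (q x) * F x := fun F => by
    rw [L2.inner_def]
    refine integral_congr_ae (Eventually.of_forall fun x => ?_)
    simp [mul_comm]
  have hT : ∀ ψ, IsTest ψ a b → ∫ x in Ioo a b, w x * ψ x = 0 →
      ∫ x in Ioo a b, star (q x) * ψ x = 0 := fun ψ hψ h0 => by
    rw [← (Submodule.mem_orthogonal' _ _).1 hq _ (toLp_mem_testRange hab s hψ h0), hin]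
    refine integral_congr_ae ?_
    filter_upwards [hψ.memLp.coeFn_toLp] with x hx
    rw [hx]
  obtain ⟨θ, hθ, hθ0⟩ := exists_integral_powC_mul_ne_zero hab (-(s + 1 / 2))
  set c := (∫ x in Ioo a b, star (q x) * θ x) / ∫ x in Ioo a b, w x * θ x with hc
  have hLw : LocallyIntegrableOn w (Ioo a b) := locallyIntegrableOn_powC _
  have hLQ := locallyIntegrableOn_of_memLp hQ
  have hae : (fun x => star (q x) - c * w x) =ᵐ[volume.restrict (Ioo a b)] 0 := by
    refine ae_eq_zero_of_integral_test_eq_zero (hLQ.sub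
      (hLw.continuousOn_mul continuousOn_const isOpen_Ioo.isLocallyClosed)) fun g hg => ?_
    have hI1 := hg.integrable_mul hLw
    have hI2 := hg.integrable_mul hLQ
    -- Subtracting `l θ` from an arbitrary test function `g` makes its moment against `w` zero; the
    -- constant `c` above is the one that `θ` then forces.
    set l := (∫ x in Ioo a b, w x * g x) / ∫ x in Ioo a b, w x * θ x with hl
    have h1 := hT _ (hg.sub_const_mul hθ l) (by
      have : ∀ x, w x * (g x - l * θ x) = w x * g x - l * (w x * θ x) := fun x => by ring
      simp only [this]
      rw [integral_sub hI1 ((hθ.integrable_mul hLw).const_mul l), integral_const_mul, hl,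
        div_mul_cancel₀ _ hθ0, sub_self])
    have e1 : ∀ x, star (q x) * (g x - l * θ x) = star (q x) * g x - l * (star (q x) * θ x) :=
      fun x => by ring
    simp only [e1] at h1
    rw [integral_sub hI2 ((hθ.integrable_mul hLQ).const_mul l), integral_const_mul] at h1
    have e2 : ∀ x, g x * (star (q x) - c * w x) = star (q x) * g x - c * (w x * g x) :=
      fun x => by ring
    simp only [e2]
    rw [integral_sub hI2 (hI1.const_mul c), integral_const_mul, ← h1, hc, hl]
    ring
  rw [hin]
  have hE : ∫ x in Ioo a b, star (q x) * G x = c * ∫ x in Ioo a b, w x * G x := by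
    rw [← integral_const_mul]
    refine integral_congr_ae ?_
    filter_upwards [hae] with x hx
    rw [sub_eq_zero.1 hx]
    ring
  rw [hE]
  rcases eq_or_ne c 0 with h0 | h0
  · rw [h0, zero_mul]
  · rw [hG ((hQ.const_mul c⁻¹).ae_eq ?_), mul_zero]
    filter_upwards [hae] with x hx
    rw [sub_eq_zero.1 hx, inv_mul_cancel_left₀ h0]

/-- Density only supplies convergence of second components; the bound `hK` makes the first
components converge to `p.1` as well. -/
theorem mem_closure_graph_opSmooth {s K : ℝ} {p : L2Ioo a b × L2Ioo a b}
    (hp : p.2 ∈ (testRange s a b).topologicalClosure)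
    (hK : ∀ q ∈ (opSmooth s a b).graph, ‖q.1 - p.1‖ ≤ K * ‖q.2 - p.2‖) :
    p ∈ (opSmooth s a b).graph.topologicalClosure := by
  obtain ⟨u, hu, hup⟩ := mem_closure_iff_seq_limit.1 hp
  choose v hv hvu using hu
  have h2 : Tendsto (fun n => (v n).2) atTop (𝓝 p.2) := hup.congr fun n => (hvu n).symm
  have h1 : Tendsto (fun n => (v n).1) atTop (𝓝 p.1) := by
    rw [tendsto_iff_norm_sub_tendsto_zero] at h2 ⊢
    refine squeeze_zero (fun n => norm_nonneg _) (fun n => hK _ (hv n)) ?_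
    simpa using h2.const_mul K
  exact mem_closure_iff_seq_limit.2 ⟨v, hv, h1.prodMk_nhds h2⟩

theorem graph_opPreMin_le_closure (hab : a < b) (s : ℝ) :
    (opPreMin s a b).graph ≤ (opSmooth s a b).graph.topologicalClosure := by
  intro p hp
  obtain ⟨K, hK⟩ := norm_le_of_mem_graph_opPreMin hab s
  refine mem_closure_graph_opSmooth (K := K) (mem_closure_testRange hab s _ fun hw => ?_)
    fun q hq => hK (q - p) (sub_mem (opSmooth_graph_le_opPreMin_graph s hq) hp)
  obtain ⟨⟨g, hg, h1, h2⟩, hc⟩ := mem_graph_opPreMin.1 hp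
  obtain ⟨c, d, hac, hcd, hdb, h0⟩ := eqOn_zero_of_compactlySupported hc hab hg h1
  have hs : s < 0 := by linarith [(memLp_powC_iff hab).1 hw]
  have hI : IntervalIntegrable (fun t => powC a (-(s + 1 / 2)) t * p.2 t) volume a b := by
    rw [intervalIntegrable_iff_integrableOn_Ioo_of_le hab.le]
    exact hw.integrable_mul (Lp.memLp p.2)
  rw [← integral_Ioc_eq_integral_Ioo, ← intervalIntegral.integral_of_le hab.le]
  -- For `s < 0` the moment of `p.2` against the weight is zero: near `b` the function `g` vanishes,
  -- so the integral from `a` to `x` in its representation does too, and `x` tends to `b`.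
  refine tendsto_nhds_unique (tendsto_integral_right hI hab) (tendsto_const_nhds.congr' ?_)
  filter_upwards [Ioo_mem_nhdsLT hdb] with x hx
  have hx' : x ∈ Ioo a b := ⟨(hac.trans_le hcd).trans hx.1, hx.2⟩
  have h3 := eq_integral_left hg (Lp.memLp p.2) h2 hs hab (by
      filter_upwards [Ioo_mem_nhdsGT hac] with x hx
      exact h0 x ⟨hx.1, hx.2.trans (hcd.trans_lt hdb)⟩ fun h => hx.2.not_ge h.1) hx'
  rw [h0 x hx' fun h => hx.1.not_ge h.2] at h3
  exact ((mul_eq_zero.1 h3.symm).resolve_left (powC_ne_zero hx'.1)).symm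

theorem isClosable_opPreMin (hab : a < b) (s : ℝ) : (opPreMin s a b).IsClosable :=
  isClosable_domRestrict s hab _

theorem isClosable_opSmooth (hab : a < b) (s : ℝ) : (opSmooth s a b).IsClosable :=
  isClosable_domRestrict s hab _

theorem graph_opMin (hab : a < b) (s : ℝ) :
    (opMin s a b).graph = (opSmooth s a b).graph.topologicalClosure := by
  rw [opMin, ← (isClosable_opPreMin hab s).graph_closure_eq_closure_graph]
  refine le_antisymm ?_ (Submodule.topologicalClosure_mono (opSmooth_graph_le_opPreMin_graph s))
  exact Submodule.topologicalClosure_minimal _ (graph_opPreMin_le_closure hab s)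
    (Submodule.isClosed_topologicalClosure _)

theorem opMin_eq_closure_opSmooth (hab : a < b) (s : ℝ) :
    opMin s a b = (opSmooth s a b).closure :=
  LinearPMap.eq_of_eq_graph <| by
    rw [graph_opMin hab, (isClosable_opSmooth hab s).graph_closure_eq_closure_graph]

theorem opMin_le_opMax (hab : a < b) (s : ℝ) : opMin s a b ≤ opMax s a b := by
  refine LinearPMap.le_of_le_graph ?_
  rw [graph_opMin hab]
  exact Submodule.topologicalClosure_minimal _
    (LinearPMap.le_graph_of_le LinearPMap.domRestrict_le) (isClosed_opMax s hab)

end FirstOrderBessel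

namespace FirstOrderBessel

/-! ### Domains, Hardy's inequality and strict inclusions -/

open scoped InnerProductSpace

variable {a b : ℝ}

theorem powC_mul_powC {r t x : ℝ} (hx : a < x) : powC a r x * powC a t x = powC a (r + t) x := by
  rw [powC, powC, powC, Real.rpow_add (sub_pos.2 hx), Complex.ofReal_mul]

theorem alpha_eq {s x : ℝ} {φ : ℝ → ℂ} :
    alpha s a φ x = deriv φ x - ((s + 1 / 2 : ℝ) : ℂ) * (powC a (-1) x * φ x) := by
  rw [alpha, powC, Real.rpow_neg_one]
  push_cast
  ring

/-! ### Description of the domains by boundary conditions. -/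

section Domains

variable {s : ℝ} {f : L2Ioo a b} {P Q : (ℝ → ℂ) → Prop}

theorem mem_acDomain_iff : f ∈ acDomain s a b P ↔ ∃ F : L2Ioo a b, ∃ g : ℝ → ℂ, LocAC g a b ∧
    f =ᵐ[volume.restrict (Ioo a b)] g ∧ F =ᵐ[volume.restrict (Ioo a b)] alpha s a g ∧ P g := by
  constructor
  · rintro ⟨g, hg, h1, h2, h3⟩
    exact ⟨h3.toLp, g, hg, h1, h3.coeFn_toLp, h2⟩
  · rintro ⟨F, g, hg, h1, h2, h3⟩
    exact ⟨g, hg, h1, h3, (memLp_congr_ae h2).1 (Lp.memLp F)⟩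

theorem domain_opMax (s a b : ℝ) :
    ((opMax s a b).domain : Set (L2Ioo a b)) = acDomain s a b fun _ => True := by
  ext f
  rw [SetLike.mem_coe, LinearPMap.mem_domain_iff, mem_acDomain_iff, graph_opMax]
  refine exists_congr fun F => ⟨?_, ?_⟩
  · rintro ⟨g, hg, h1, h2⟩
    exact ⟨g, hg, h1, h2, trivial⟩
  · rintro ⟨g, hg, h1, h2, -⟩
    exact ⟨g, hg, h1, h2⟩

theorem acDomain_congr (h : ∀ g, LocAC g a b → MemLp g 2 (volume.restrict (Ioo a b)) →
    MemLp (alpha s a g) 2 (volume.restrict (Ioo a b)) → (P g ↔ Q g)) :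
    acDomain s a b P = acDomain s a b Q := by
  ext f
  refine exists_congr fun g => ⟨?_, ?_⟩
  · rintro ⟨hg, h1, h2, h3⟩
    exact ⟨hg, h1, (h g hg ((memLp_congr_ae h1).1 (Lp.memLp f)) h3).1 h2, h3⟩
  · rintro ⟨hg, h1, h2, h3⟩
    exact ⟨hg, h1, (h g hg ((memLp_congr_ae h1).1 (Lp.memLp f)) h3).2 h2, h3⟩

theorem domain_opMax_eq_acDomain (h : ∀ g, LocAC g a b →
    MemLp g 2 (volume.restrict (Ioo a b)) → MemLp (alpha s a g) 2 (volume.restrict (Ioo a b)) →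
      P g) : ((opMax s a b).domain : Set (L2Ioo a b)) = acDomain s a b P := by
  rw [domain_opMax]
  exact acDomain_congr fun g h1 h2 h3 => ⟨fun _ => h g h1 h2 h3, fun _ => trivial⟩

theorem vanishesRight_solution (hab : a < b) {G : ℝ → ℂ}
    (hG : MemLp G 2 (volume.restrict (Ioo a b))) (h : ℝ) :
    VanishesRight b (solution a h b 0 G) := by
  obtain ⟨m, hm⟩ := exists_between hab
  have h1 := intervalIntegral.continuousOn_primitive_interval' (intervalIntegrable_powC_mul hG (-h)
    (Ioo_subset_Ioc_self hm) ⟨hab, le_rfl⟩) right_mem_uIcc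
  rw [uIcc_of_le hm.2.le] at h1
  have h2 := ((h1 b (right_mem_Icc.2 hm.2.le)).mono Ioo_subset_Icc_self).tendsto
  rw [nhdsWithin_Ioo_eq_nhdsLT hm.2, intervalIntegral.integral_same] at h2
  have hc : Tendsto (powC a h) (𝓝[<] b) (𝓝 (powC a h b)) :=
    ((continuousOn_powC a _).continuousAt (Ioi_mem_nhds hab)).tendsto.mono_left nhdsWithin_le_nhds
  have h3 := hc.mul h2
  rw [mul_zero] at h3
  exact h3.congr fun x => by rw [solution, zero_add]

theorem IsTest.vanishesRight {φ : ℝ → ℂ} (hφ : IsTest φ a b) :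
    VanishesRight b φ := by
  have := hφ.1.continuous.tendsto b
  rw [hφ.eq_zero fun h => h.2.false] at this
  exact this.mono_left nhdsWithin_le_nhds

/-- Only the condition at `b` matters, since decay at `a` is automatic for `s = 0`. It survives
graph limits because it amounts to the solution formula with base point `b` and constant `0`.
Conversely it yields the a priori bound, and the range on test functions is dense. -/
theorem domain_opMin_zero (hab : a < b) : ((opMin 0 a b).domain : Set (L2Ioo a b)) =
    acDomain 0 a b (VanishesRight b) := by
  ext f
  rw [SetLike.mem_coe, LinearPMap.mem_domain_iff, mem_acDomain_iff, graph_opMin hab]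
  refine exists_congr fun F => ⟨fun hF => ?_, ?_⟩
  · have hb : b ∈ Ioc a b := ⟨hab, le_rfl⟩
    refine ⟨solution a (0 + 1 / 2) b 0 F, locAC_solution (Lp.memLp F) hb _ _, ?_,
      (alpha_solution (Lp.memLp F) hb 0 0).symm, vanishesRight_solution hab (Lp.memLp F) _⟩
    obtain ⟨v, hv, hvp⟩ := mem_closure_iff_seq_limit.1 hF
    have h1 : Tendsto (fun n => (v n).1) atTop (𝓝 f) := (continuous_fst.tendsto (f, F)).comp hvp
    have h2 : Tendsto (fun n => (v n).2) atTop (𝓝 F) := (continuous_snd.tendsto (f, F)).comp hvp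
    refine ae_eq_of_tendsto_of_ae_tendsto h1 ?_
    have hae : ∀ n, ∀ᵐ x ∂(volume.restrict (Ioo a b)),
        (v n).1 x = solution a (0 + 1 / 2) b 0 (v n).2 x := fun n => by
      obtain ⟨φ, hφ, e1, e2⟩ := mem_graph_opSmooth.1 (hv n)
      filter_upwards [e1, ae_restrict_mem measurableSet_Ioo] with x hx hxm
      rw [hx, eq_neg_integral_right hφ.locAC (Lp.memLp (v n).2) e2 (hφ.vanishesRight) hxm,
        solution, intervalIntegral.integral_symm, mul_neg, neg_neg, zero_add (∫ t in b..x, _)]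
    filter_upwards [ae_all_iff.2 hae, ae_restrict_mem measurableSet_Ioo] with x hx hxm
    simp only [hx]
    exact ((tendsto_intervalIntegral_powC_mul hb (Ioo_subset_Ioc_self hxm) _ h2).const_add
      0).const_mul _
  · rintro ⟨g, hg, h1, h2, h3⟩
    have hp : (f, F) ∈ maxGraph 0 a b := ⟨g, hg, h1, h2⟩
    obtain ⟨K, hK⟩ := norm_le_of_vanishesRight hab le_rfl
    refine mem_closure_graph_opSmooth (K := K) (mem_closure_testRange hab 0 F fun hw => ?_)
      fun q hq => ?_
    -- At `s = 0` the weight `(x - a)^(-1/2)` just fails to be square integrable, so there is no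
    -- moment condition to check.
    · have := (memLp_powC_iff hab).1 hw
      norm_num at this
    · obtain ⟨φ, hφ, e1, e2⟩ := mem_graph_opSmooth.1 hq
      have hq' : q ∈ maxGraph 0 a b := ⟨φ, hφ.locAC, e1, e2⟩
      obtain ⟨r, hr, d1, d2⟩ := sub_mem hq' hp
      refine hK _ _ r hr d1 d2 ?_
      have hE : EqOn r (φ - g) (Ioo a b) := eqOn_of_ae_eq hr.continuousOn
        (hφ.1.continuous.continuousOn.sub hg.continuousOn)
        (d1.symm.trans ((Lp.coeFn_sub _ _).trans (e1.sub h1)))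
      have h4 := (hφ.vanishesRight).sub h3
      rw [sub_zero] at h4
      refine h4.congr' ?_
      filter_upwards [Ioo_mem_nhdsLT hab] with x hx using (hE hx).symm

end Domains

/-! ### Hardy's inequality and comparison of the minimal domain with `H_0^1`. -/

section Hardy

theorem IsTest.integral_deriv_eq_zero (hab : a < b) {φ : ℝ → ℂ} (hφ : IsTest φ a b) :
    ∫ x in Ioo a b, deriv φ x = 0 := by
  rw [← integral_Ioc_eq_integral_Ioo, ← intervalIntegral.integral_of_le hab.le,
    intervalIntegral.integral_deriv_eq_sub (fun x _ => hφ.1.differentiable (by simp) x)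
      ((hφ.1.continuous_deriv (by simp)).intervalIntegrable _ _),
    hφ.eq_zero fun h => h.2.false, hφ.eq_zero fun h => h.1.false, sub_zero]

/-- The identity `2 Re ⟪φ / (x - a), φ'⟫ = ‖φ / (x - a)‖ ^ 2` behind Hardy's inequality. -/
theorem hardy_identity (hab : a < b) {φ : ℝ → ℂ} (hφ : IsTest φ a b) {D Φ : L2Ioo a b}
    (hD : D =ᵐ[volume.restrict (Ioo a b)] deriv φ)
    (hΦ : Φ =ᵐ[volume.restrict (Ioo a b)] fun x => powC a (-1) x * φ x) :
    2 * RCLike.re ⟪Φ, D⟫_ℂ = ‖Φ‖ ^ 2 := by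
  -- The identity is the vanishing of the integral of the derivative of `|φ|² / (x - a)`.
  have hψ : IsTest (fun x => (powC a (-1) x * star (φ x)) * φ x) a b :=
    hφ.mul_left ((contDiffOn_powC a (-1)).mul
      (Complex.conjCLE.contDiff.comp hφ.1).contDiffOn)
  have h0 := hψ.integral_deriv_eq_zero hab
  have h1 : ⟪Φ, D⟫_ℂ + ⟪D, Φ⟫_ℂ - ⟪Φ, Φ⟫_ℂ = 0 := by
    rw [← h0, L2.inner_def, L2.inner_def, L2.inner_def,
      ← integral_add (L2.integrable_inner Φ D) (L2.integrable_inner D Φ),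
      ← integral_sub ((L2.integrable_inner Φ D).add (L2.integrable_inner D Φ))
        (L2.integrable_inner Φ Φ)]
    refine integral_congr_ae ?_
    filter_upwards [hD, hΦ, ae_restrict_mem measurableSet_Ioo] with x h1 h2 hx
    have hd := (hφ.1.differentiable (by simp) x).hasDerivAt
    have h3 := ((hasDerivAt_powC (r := -1) hx.1).mul hd.star).mul hd
    rw [show deriv (fun x => (powC a (-1) x * star (φ x)) * φ x) x = _ from h3.deriv, h1, h2]
    have hp : star (powC a (-1) x) = powC a (-1) x := by
      rw [powC]
      exact Complex.conj_ofReal _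
    have h4 : ((-1 / (x - a) : ℝ) : ℂ) = -powC a (-1) x := by
      rw [powC, Real.rpow_neg_one]
      push_cast
      ring
    simp only [RCLike.inner_apply, map_mul, Pi.mul_apply, h4] at hp ⊢
    rw [← starRingEnd_apply] at hp
    simp only [hp, ← starRingEnd_apply]
    ring
  have h2 := congrArg RCLike.re h1
  rw [map_sub, map_add, inner_re_symm (𝕜 := ℂ) D Φ, inner_self_eq_norm_sq (𝕜 := ℂ), map_zero] at h2
  linarith

theorem exists_quotient_of_mem_testGraph (hab : a < b) {p : L2Ioo a b × L2Ioo a b}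
    (hp : p ∈ testGraph a b) (s : ℝ) : ∃ Φ : L2Ioo a b,
    Φ =ᵐ[volume.restrict (Ioo a b)] (fun x => powC a (-1) x * p.1 x) ∧
    ‖Φ‖ ≤ 2 * ‖p.2‖ ∧ (p.1, p.2 - ((s + 1 / 2 : ℝ) : ℂ) • Φ) ∈ (opSmooth s a b).graph := by
  obtain ⟨φ, hφ, h1, h2⟩ := hp
  have hm := (hφ.powC_mul (-1)).memLp
  have hae := hm.coeFn_toLp
  refine ⟨hm.toLp, ?_, ?_, ?_⟩
  · filter_upwards [hae, h1] with x e1 e2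
    rw [e1, e2]
  · have h3 := hardy_identity hab hφ h2 hae
    have h4 := (RCLike.re_le_norm ⟪hm.toLp, p.2⟫_ℂ).trans (norm_inner_le_norm _ _)
    nlinarith [norm_nonneg hm.toLp, norm_nonneg p.2]
  · refine mem_graph_opSmooth.2 ⟨φ, hφ, h1, ?_⟩
    filter_upwards [hae, h2, Lp.coeFn_sub p.2 (((s + 1 / 2 : ℝ) : ℂ) • hm.toLp),
      Lp.coeFn_smul ((s + 1 / 2 : ℝ) : ℂ) hm.toLp] with x e1 e2 e3 e4
    rw [e3, Pi.sub_apply, e4, Pi.smul_apply, e1, e2, alpha_eq, smul_eq_mul]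

/-- Inserting `φ' = α_s φ + (s + 1/2) Φ`, with `Φ = φ/(x - a)`, in the Hardy identity leaves `Re ⟪Φ,
α_s φ⟫ = -s ‖Φ‖²`. Cauchy–Schwarz then gives the constant `|s|⁻¹`, which is where `s = 0` drops out.
-/
theorem exists_quotient_of_mem_graph_opSmooth (hab : a < b) {s : ℝ} (hs : s ≠ 0)
    {p : L2Ioo a b × L2Ioo a b} (hp : p ∈ (opSmooth s a b).graph) : ∃ Φ : L2Ioo a b,
    Φ =ᵐ[volume.restrict (Ioo a b)] (fun x => powC a (-1) x * p.1 x) ∧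
    ‖Φ‖ ≤ |s|⁻¹ * ‖p.2‖ ∧ (p.1, p.2 + ((s + 1 / 2 : ℝ) : ℂ) • Φ) ∈ testGraph a b := by
  obtain ⟨φ, hφ, h1, h2⟩ := mem_graph_opSmooth.1 hp
  have hm := (hφ.powC_mul (-1)).memLp
  have hae := hm.coeFn_toLp
  have hD : (p.2 + ((s + 1 / 2 : ℝ) : ℂ) • hm.toLp : L2Ioo a b)
      =ᵐ[volume.restrict (Ioo a b)] deriv φ := by
    filter_upwards [hae, h2, Lp.coeFn_add p.2 (((s + 1 / 2 : ℝ) : ℂ) • hm.toLp),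
      Lp.coeFn_smul ((s + 1 / 2 : ℝ) : ℂ) hm.toLp] with x e1 e2 e3 e4
    rw [e3, Pi.add_apply, e4, Pi.smul_apply, e1, e2, alpha_eq, smul_eq_mul, sub_add_cancel]
  refine ⟨hm.toLp, ?_, ?_, φ, hφ, h1, hD⟩
  · filter_upwards [hae, h1] with x e1 e2
    rw [e1, e2]
  · have h3 := hardy_identity hab hφ hD hae
    rw [inner_add_right, inner_smul_right, map_add, RCLike.re_to_complex, RCLike.re_to_complex,
      Complex.re_ofReal_mul, ← RCLike.re_to_complex, ← RCLike.re_to_complex,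
      inner_self_eq_norm_sq (𝕜 := ℂ)] at h3
    have h4 := (RCLike.abs_re_le_norm ⟪hm.toLp, p.2⟫_ℂ).trans (norm_inner_le_norm _ _)
    have h5 : RCLike.re ⟪hm.toLp, p.2⟫_ℂ = -s * ‖hm.toLp‖ ^ 2 := by linarith
    rw [h5, abs_mul, abs_neg, abs_of_nonneg (sq_nonneg ‖hm.toLp‖)] at h4
    have hs' := abs_pos.2 hs
    rw [inv_mul_eq_div, le_div_iff₀ hs']
    rcases (norm_nonneg hm.toLp).eq_or_lt with h0 | h0
    · rw [← h0, zero_mul]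
      exact norm_nonneg _
    · nlinarith

/-- The bound applies to differences of elements of `T`, so the weighted functions form a Cauchy
sequence; an almost everywhere convergent subsequence identifies the limit. -/
theorem exists_quotient_of_mem_closure {T : Submodule ℂ (L2Ioo a b × L2Ioo a b)} {w : ℝ → ℂ}
    {K : ℝ} (hT : ∀ p ∈ T, ∀ Φ : L2Ioo a b,
      Φ =ᵐ[volume.restrict (Ioo a b)] (fun x => w x * p.1 x) → ‖Φ‖ ≤ K * ‖p.2‖)
    {v : ℕ → L2Ioo a b × L2Ioo a b} (hv : ∀ n, v n ∈ T) {p : L2Ioo a b × L2Ioo a b}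
    (hvp : Tendsto v atTop (𝓝 p)) {Φ : ℕ → L2Ioo a b}
    (hΦ : ∀ n, Φ n =ᵐ[volume.restrict (Ioo a b)] fun x => w x * (v n).1 x) :
    ∃ Ψ : L2Ioo a b, Tendsto Φ atTop (𝓝 Ψ) ∧
      Ψ =ᵐ[volume.restrict (Ioo a b)] fun x => w x * p.1 x := by
  have h1 : Tendsto (fun n => (v n).1) atTop (𝓝 p.1) := (continuous_fst.tendsto p).comp hvp
  have h2 : Tendsto (fun n => (v n).2) atTop (𝓝 p.2) := (continuous_snd.tendsto p).comp hvp
  have hc : CauchySeq Φ := by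
    rw [cauchySeq_iff_tendsto_dist_atTop_0]
    have h3 := (cauchySeq_iff_tendsto_dist_atTop_0.1 h2.cauchySeq).const_mul K
    rw [mul_zero] at h3
    refine squeeze_zero (fun _ => dist_nonneg) (fun n => ?_) h3
    rw [dist_eq_norm, dist_eq_norm]
    refine hT (v n.1 - v n.2) (sub_mem (hv _) (hv _)) _ ?_
    filter_upwards [hΦ n.1, hΦ n.2, Lp.coeFn_sub (Φ n.1) (Φ n.2),
      Lp.coeFn_sub (v n.1).1 (v n.2).1] with x e1 e2 e3 e4
    rw [e3, Prod.fst_sub, e4, Pi.sub_apply, Pi.sub_apply, e1, e2, mul_sub]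
  obtain ⟨Ψ, hΨ⟩ := cauchySeq_tendsto_of_complete hc
  refine ⟨Ψ, hΨ, ?_⟩
  obtain ⟨k, hk, hae⟩ := exists_subseq_ae_tendsto h1
  refine ae_eq_of_tendsto_of_ae_tendsto (hΨ.comp hk.tendsto_atTop) ?_
  filter_upwards [hae, ae_all_iff.2 hΦ] with x e1 e2
  simp only [Function.comp_apply, e2]
  exact e1.const_mul _

theorem exists_quotient_of_mem_H01 (hab : a < b) (s : ℝ) {f : L2Ioo a b} (hf : f ∈ H01 a b) :
    f ∈ (opMin s a b).domain ∧
      MemLp (fun x => powC a (-1) x * f x) 2 (volume.restrict (Ioo a b)) := by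
  obtain ⟨p, hp, rfl⟩ := hf
  obtain ⟨v, hv, hvp⟩ := mem_closure_iff_seq_limit.1 hp
  choose Φ hΦ _ hS using fun n => exists_quotient_of_mem_testGraph hab (hv n) s
  obtain ⟨Ψ, h1, h2⟩ := exists_quotient_of_mem_closure (K := 2) (fun q hq Θ hΘ => by
    obtain ⟨Θ', e1, e2, -⟩ := exists_quotient_of_mem_testGraph hab hq s
    rwa [Lp.ext (hΘ.trans e1.symm)]) hv hvp hΦ
  refine ⟨?_, (memLp_congr_ae h2).1 (Lp.memLp Ψ)⟩
  rw [LinearPMap.mem_domain_iff, graph_opMin hab]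
  refine ⟨p.2 - ((s + 1 / 2 : ℝ) : ℂ) • Ψ, mem_closure_iff_seq_limit.2 ⟨_, hS, ?_⟩⟩
  exact ((continuous_fst.tendsto p).comp hvp).prodMk_nhds
    (((continuous_snd.tendsto p).comp hvp).sub (h1.const_smul _))

theorem H01_le_domain_opMin (hab : a < b) (s : ℝ) : H01 a b ≤ (opMin s a b).domain :=
  fun _ hf => (exists_quotient_of_mem_H01 hab s hf).1

theorem domain_opMin_eq_H01 (hab : a < b) {s : ℝ} (hs : s ≠ 0) :
    (opMin s a b).domain = H01 a b := by
  refine le_antisymm (fun f hf => ?_) (H01_le_domain_opMin hab s)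
  rw [LinearPMap.mem_domain_iff, graph_opMin hab] at hf
  obtain ⟨F, hF⟩ := hf
  obtain ⟨v, hv, hvp⟩ := mem_closure_iff_seq_limit.1 hF
  choose Φ hΦ _ hS using fun n => exists_quotient_of_mem_graph_opSmooth hab hs (hv n)
  obtain ⟨Ψ, h1, -⟩ := exists_quotient_of_mem_closure (K := |s|⁻¹) (fun q hq Θ hΘ => by
    obtain ⟨Θ', e1, e2, -⟩ := exists_quotient_of_mem_graph_opSmooth hab hs hq
    rwa [Lp.ext (hΘ.trans e1.symm)]) hv hvp hΦ
  refine ⟨(f, F + ((s + 1 / 2 : ℝ) : ℂ) • Ψ), mem_closure_iff_seq_limit.2 ⟨_, hS, ?_⟩, rfl⟩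
  exact ((continuous_fst.tendsto (f, F)).comp hvp).prodMk_nhds
    (((continuous_snd.tendsto (f, F)).comp hvp).add (h1.const_smul _))

end Hardy

/-! ### Cores of the minimal operator. -/

section Cores

theorem domRestrict_opMin (hab : a < b) {s : ℝ} {S : Submodule ℂ (L2Ioo a b)}
    (hS : S ≤ (opMin s a b).domain) :
    (opMin s a b).domRestrict S = (opMax s a b).domRestrict S := by
  refine LinearPMap.eq_of_eq_graph (Submodule.ext fun p => ?_)
  rw [mem_graph_domRestrict, mem_graph_domRestrict]
  refine and_congr_left fun hp => ⟨fun h => LinearPMap.le_graph_of_le (opMin_le_opMax hab s) h,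
    fun h => ?_⟩
  obtain ⟨F, hF⟩ := LinearPMap.mem_domain_iff.1 (hS hp)
  have := LinearPMap.le_graph_of_le (opMin_le_opMax hab s) hF
  have hE : p.2 = F := LinearPMap.mem_graph_snd_inj _ h this rfl
  rwa [← hE] at hF

theorem hasCore_opMin_of_testSpace_le (hab : a < b) {s : ℝ} {S : Submodule ℂ (L2Ioo a b)}
    (hS : S ≤ (opMin s a b).domain) (hT : testSpace a b ≤ S) : (opMin s a b).HasCore S := by
  refine ⟨hS, le_antisymm ?_ ?_⟩
  · have hcl : (opMin s a b).IsClosed := (isClosable_opPreMin hab s).closure_isClosed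
    refine (hcl.isClosable.closure_mono LinearPMap.domRestrict_le).trans_eq ?_
    refine LinearPMap.eq_of_eq_graph ?_
    rw [← hcl.isClosable.graph_closure_eq_closure_graph]
    exact hcl.submodule_topologicalClosure_eq
  · rw [domRestrict_opMin hab hS,
      opMin_eq_closure_opSmooth hab]
    refine (isClosable_domRestrict s hab S).closure_mono (LinearPMap.le_of_le_graph fun p hp => ?_)
    rw [opSmooth, mem_graph_domRestrict] at hp
    exact mem_graph_domRestrict.2 ⟨hp.1, hT hp.2⟩

theorem testSpace_le_H01 : testSpace a b ≤ H01 a b :=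
  Submodule.map_mono (Submodule.le_topologicalClosure _)

end Cores

/-! ### Explicit functions witnessing the strict inclusions. -/

section Strictness

theorem locAC_powC (r : ℝ) : LocAC (powC a r) a b := fun _ _ hc hcd _ =>
  absolutelyContinuousOnInterval_powC r hc (hc.trans_le hcd)

/-- The witness is the homogeneous solution `(x - a)^(s + 1/2)`: it lies in `L²` since `s > -1`, but
its quotient by `x - a` does not since `s < 0`, so it is not in `H_0^1`. -/
theorem domain_opMin_lt_domain_opMax (hab : a < b) {s : ℝ} (hs : s ∈ Ioo (-1 : ℝ) 0) :
    (opMin s a b).domain < (opMax s a b).domain := by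
  refine lt_of_le_not_ge (opMin_le_opMax hab s).1 fun hle => ?_
  have hm : MemLp (powC a (s + 1 / 2)) 2 (volume.restrict (Ioo a b)) :=
    (memLp_powC_iff hab).2 (by linarith [hs.1])
  have hd : hm.toLp ∈ ((opMax s a b).domain : Set (L2Ioo a b)) := by
    rw [domain_opMax]
    refine ⟨_, locAC_powC _, hm.coeFn_toLp, trivial, (memLp_congr_ae ?_).1 MemLp.zero⟩
    filter_upwards [ae_restrict_mem measurableSet_Ioo] with x hx
    rw [alpha, (hasDerivAt_powC hx.1).deriv, sub_self]
    rfl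
  have hf := hle hd
  rw [domain_opMin_eq_H01 hab hs.2.ne] at hf
  have h1 := (exists_quotient_of_mem_H01 hab s hf).2
  have h2 : MemLp (powC a (-1 + (s + 1 / 2))) 2 (volume.restrict (Ioo a b)) := by
    refine h1.ae_eq ?_
    filter_upwards [hm.coeFn_toLp, ae_restrict_mem measurableSet_Ioo] with x hx hxm
    rw [hx, powC_mul_powC hxm.1]
  linarith [(memLp_powC_iff hab).1 h2, hs.2]

theorem H01_lt_domain_opMin_zero (hab : a < b) : H01 a b < (opMin 0 a b).domain := by
  refine lt_of_le_not_ge (H01_le_domain_opMin hab 0) fun hle => ?_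
  -- The witness is `(x - a)^(1/2) (1 - (x - a)/(b - a))`: the homogeneous solution corrected to
  -- vanish at `b`, with `α_0` of it equal to `c (x - a)^(1/2)`.
  set c : ℂ := ((-(b - a)⁻¹ : ℝ) : ℂ) with hc
  have h12 : MemLp (powC a (1 / 2)) 2 (volume.restrict (Ioo a b)) :=
    (memLp_powC_iff hab).2 (by norm_num)
  have h32 : MemLp (powC a (3 / 2)) 2 (volume.restrict (Ioo a b)) :=
    (memLp_powC_iff hab).2 (by norm_num)
  have hm : MemLp (powC a (1 / 2) + c • powC a (3 / 2)) 2 (volume.restrict (Ioo a b)) :=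
    h12.add (h32.const_smul c)
  have hd : hm.toLp ∈ ((opMin 0 a b).domain : Set (L2Ioo a b)) := by
    rw [domain_opMin_zero hab]
    refine ⟨_, (locAC_powC _).add ((locAC_powC _).const_smul c), hm.coeFn_toLp, ?_,
      (memLp_congr_ae ?_).1 (h12.const_smul c)⟩
    · have hcont : ContinuousAt (powC a (1 / 2) + c • powC a (3 / 2)) b :=
        ((continuousOn_powC a _).continuousAt (Ioi_mem_nhds hab)).add
          (((continuousOn_powC a _).continuousAt (Ioi_mem_nhds hab)).const_smul c)
      have h0 : (powC a (1 / 2) + c • powC a (3 / 2)) b = 0 := by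
        have hba : 0 < b - a := sub_pos.2 hab
        have h1 : (b - a) ^ (3 / 2 : ℝ) = (b - a) ^ (1 / 2 : ℝ) * (b - a) := by
          rw [← Real.rpow_add_one hba.ne']
          norm_num
        simp only [Pi.add_apply, Pi.smul_apply, smul_eq_mul, hc, powC]
        rw [← Complex.ofReal_mul, ← Complex.ofReal_add, h1, Complex.ofReal_eq_zero]
        field_simp
        ring
      have h1 := hcont.tendsto
      rw [h0] at h1
      exact h1.mono_left nhdsWithin_le_nhds
    · filter_upwards [ae_restrict_mem measurableSet_Ioo] with x hx
      have hd := (hasDerivAt_powC (r := 1 / 2) hx.1).add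
        ((hasDerivAt_powC (r := 3 / 2) hx.1).const_smul c)
      have h1 : powC a (3 / 2) x = powC a 1 x * powC a (1 / 2) x := by
        rw [powC_mul_powC hx.1]
        norm_num
      have hx0 : ((x - a : ℝ) : ℂ) ≠ 0 := Complex.ofReal_ne_zero.2 (sub_pos.2 hx.1).ne'
      have h2 : powC a 1 x = ((x - a : ℝ) : ℂ) := by rw [powC, Real.rpow_one]
      rw [alpha, hd.deriv]
      simp only [Pi.add_apply, Pi.smul_apply, smul_eq_mul, h1, h2, Complex.ofReal_div]
      field_simp
      push_cast
      ring
  have h1 := (exists_quotient_of_mem_H01 hab 0 (hle hd)).2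
  -- Dividing the witness by `x - a` and removing the square integrable term `c (x - a)^(1/2)`
  -- leaves `(x - a)^(-1/2)`, which is not in `L²`.
  have h2 : MemLp (powC a (-1 + 1 / 2)) 2 (volume.restrict (Ioo a b)) := by
    refine (h1.sub (h12.const_mul c)).ae_eq ?_
    filter_upwards [hm.coeFn_toLp, ae_restrict_mem measurableSet_Ioo] with x hx hxm
    have h3 : powC a (1 / 2) x = powC a (-1) x * powC a (3 / 2) x := by
      rw [powC_mul_powC hxm.1]
      norm_num
    rw [Pi.sub_apply, hx, ← powC_mul_powC hxm.1, Pi.add_apply, Pi.smul_apply, smul_eq_mul]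
    linear_combination (-c) * h3
  have := (memLp_powC_iff hab).1 h2
  norm_num at this

end Strictness

end FirstOrderBessel

theorem theorem3p2 (a b : ℝ) (hab : a < b) :
    -- the two closures defining the minimal operator make sense and agree
    (∀ s : ℝ, (opPreMin s a b).IsClosable ∧ (opSmooth s a b).IsClosable ∧
      opMin s a b = (opSmooth s a b).closure) ∧
    -- (i)
    (∀ s : ℝ, s ≠ 0 → (opMin s a b).domain = H01 a b) ∧
    -- (ii)
    ((opMin 0 a b).HasCore (testSpace a b) ∧
      (opMin 0 a b).HasCore (H01 a b) ∧
      H01 a b < (opMin 0 a b).domain ∧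
      ((opMin 0 a b).domain : Set (L2Ioo a b)) =
        acDomain 0 a b (fun f => VanishesLeft a f ∧ VanishesRight b f) ∧
      ((opMin 0 a b).domain : Set (L2Ioo a b)) =
        acDomain 0 a b (fun f => VanishesLeft a f ∧ SqrtVanishesRight b f) ∧
      ((opMax 0 a b).domain : Set (L2Ioo a b)) = acDomain 0 a b (fun _ => True) ∧
      ((opMax 0 a b).domain : Set (L2Ioo a b)) = acDomain 0 a b (fun f => VanishesLeft a f) ∧
      ∀ R : ℝ, 0 < R →
        ((opMin 0 a b).domain : Set (L2Ioo a b)) =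
          acDomain 0 a b (fun f => LogSqrtVanishesLeft R a f ∧ VanishesRight b f) ∧
        ((opMin 0 a b).domain : Set (L2Ioo a b)) =
          acDomain 0 a b (fun f => LogSqrtVanishesLeft R a f ∧ SqrtVanishesRight b f) ∧
        ((opMax 0 a b).domain : Set (L2Ioo a b)) =
          acDomain 0 a b (fun f => LogSqrtVanishesLeft R a f)) ∧
    -- (iii)
    (∀ s : ℝ, s ∈ Iic (-1 : ℝ) ∪ Ioi (0 : ℝ) →
      ((opMax s a b).domain : Set (L2Ioo a b)) = acDomain s a b (fun _ => True) ∧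
      ((opMax s a b).domain : Set (L2Ioo a b)) = acDomain s a b (fun f => VanishesLeft a f) ∧
      ((opMax s a b).domain : Set (L2Ioo a b)) = acDomain s a b (fun f => SqrtVanishesLeft a f)) ∧
    -- (iv)
    (∀ s : ℝ, s ∈ Ioo (-1 : ℝ) 0 →
      H01 a b = (opMin s a b).domain ∧ (opMin s a b).domain < (opMax s a b).domain) := by

  have hac := fun (s : ℝ) (g : ℝ → ℂ) (hg : LocAC g a b)
    (hG : MemLp (alpha s a g) 2 (volume.restrict (Ioo a b))) (hv : VanishesRight b g) =>
      SqrtVanishesRight.of_vanishesRight hg hG (ae_eq_refl _) hab hv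
  have hlog := fun (g : ℝ → ℂ) (hg : LocAC g a b)
    (hG : MemLp (alpha 0 a g) 2 (volume.restrict (Ioo a b))) (R : ℝ) (hR : 0 < R) =>
      logSqrtVanishesLeft hg hG (ae_eq_refl _) hab hR
  have hleft := fun (g : ℝ → ℂ) (hg : LocAC g a b)
    (hG : MemLp (alpha 0 a g) 2 (volume.restrict (Ioo a b))) =>
      (hlog g hg hG 1 one_pos).vanishesLeft one_pos
  have hsqrt : ∀ s ∈ Iic (-1 : ℝ) ∪ Ioi (0 : ℝ), ∀ g : ℝ → ℂ, LocAC g a b →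
      MemLp g 2 (volume.restrict (Ioo a b)) → MemLp (alpha s a g) 2 (volume.restrict (Ioo a b)) →
      SqrtVanishesLeft a g := fun s hs g hg h1 h2 => hs.elim
    (fun h => sqrtVanishesLeft_of_le_neg_one hg h2 (ae_eq_refl _) hab h1 h)
    (fun h => sqrtVanishesLeft_of_pos hg h2 (ae_eq_refl _) hab h)
  -- Every listed description of the minimal domain at `s = 0` reduces to vanishing at `b`, because
  -- the conditions at `a` hold automatically.
  have hmin : ∀ P : (ℝ → ℂ) → Prop, (∀ g, LocAC g a b →
      MemLp (alpha 0 a g) 2 (volume.restrict (Ioo a b)) → (VanishesRight b g ↔ P g)) →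
      ((opMin 0 a b).domain : Set (L2Ioo a b)) = acDomain 0 a b P := fun P hP =>
    (domain_opMin_zero hab).trans (acDomain_congr fun g hg _ h => hP g hg h)
  refine ⟨fun s => ⟨isClosable_opPreMin hab s, isClosable_opSmooth hab s,
    opMin_eq_closure_opSmooth hab s⟩, fun s hs => domain_opMin_eq_H01 hab hs,
    ⟨hasCore_opMin_of_testSpace_le hab (testSpace_le_H01.trans (H01_le_domain_opMin hab 0)) le_rfl,
      hasCore_opMin_of_testSpace_le hab (H01_le_domain_opMin hab 0) testSpace_le_H01,
      H01_lt_domain_opMin_zero hab,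
      hmin _ fun g hg h => ⟨fun hv => ⟨hleft g hg h, hv⟩, fun hv => hv.2⟩,
      hmin _ fun g hg h => ⟨fun hv => ⟨hleft g hg h, hac 0 g hg h hv⟩,
        fun hv => hv.2.vanishesRight⟩,
      domain_opMax 0 a b, domain_opMax_eq_acDomain fun g hg _ h => hleft g hg h,
      fun R hR => ⟨hmin _ fun g hg h => ⟨fun hv => ⟨hlog g hg h R hR, hv⟩, fun hv => hv.2⟩,
        hmin _ fun g hg h => ⟨fun hv => ⟨hlog g hg h R hR, hac 0 g hg h hv⟩,
          fun hv => hv.2.vanishesRight⟩,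
        domain_opMax_eq_acDomain fun g hg _ h => hlog g hg h R hR⟩⟩,
    fun s hs => ⟨domain_opMax s a b,
      domain_opMax_eq_acDomain fun g hg h1 h2 => (hsqrt s hs g hg h1 h2).vanishesLeft,
      domain_opMax_eq_acDomain fun g hg h1 h2 => hsqrt s hs g hg h1 h2⟩,
    fun s hs => ⟨(domain_opMin_eq_H01 hab hs.2.ne).symm, domain_opMin_lt_domain_opMax hab hs⟩⟩
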